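/- Conventions. $C^*$-algebras and $*$-homomorphisms are unital, $A*D$ and $*_\kappa A_\kappa$ denote full (unital) free products, and a state is a unital positive linear functional. Given states $\omega_\kappa$ on $A_\kappa$, the free product state $*_\kappa\omega_\kappa$ is the state on $*_\kappa A_\kappa$ which restricts to $\omega_\kappa$ on $A_\kappa$ for every $\kappa$ and for which the images of the $A_\kappa$ are freely independent. If $p$ is a projection in a $C^*$-algebra $P$ and $\varphi$ is a state on $P$ with $\varphi(p)\neq 0$, then $\varphi^p:=\varphi(p)^{-1}\varphi|_{pPp}$ is the compressed state on $pPp$ (an algebra with unit $p$). Let $A$ be a unital $C^*$-algebra and $B=\bigoplus_{\kappa=1}^K M_{N_\kappa}(\mathbb C)$ with $N_\kappa\ge 1$ and matrix units $e^\kappa_{ij}$. A unital $*$-homomorphism $\rho:A\to B\otimes\mathcal U$, with $\mathcal U$ a unital $C^*$-algebra, is called the universal quantum homomorphism from $A$ to $B$ if for every unital $C^*$-algebra $\mathcal U'$ and every unital $*$-homomorphism $\rho':A\to B\otimes\mathcal U'$ there is a unique unital $*$-homomorphism $\pi:\mathcal U\to\mathcal U'$ with $(\mathrm{id}\otimes\pi)\rho=\rho'$;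 the pair $(\rho,\mathcal U)$ is then unique up to a canonical isomorphism. Let $\omega$ be a state on $A$ and let $\varphi_\kappa:=\omega*\mathrm{tr}_\kappa$ be the free product state on $A*M_{N_\kappa}(\mathbb C)$, where $\mathrm{tr}_\kappa$ is the normalized trace. The canonical state $\widetilde\omega$ associated with $\omega$ is defined as follows. Put $\mathcal U_\kappa:=M_{N_\kappa}(\mathbb C)'\cap(A*M_{N_\kappa}(\mathbb C))$ and $\nu^\kappa_{ij}(a):=\sum_r e^\kappa_{ri}ae^\kappa_{jr}\in\mathcal U_\kappa$. On the model $*_\kappa\,\mathcal U_\kappa$ of the universal algebra, with $a\mapsto\sum_{\kappa,i,j}e^\kappa_{ij}\otimes\nu^\kappa_{ij}(a)$, the canonical state is the free product state $*_\kappa(\varphi_\kappa|_{\mathcal U_\kappa})$; on any other model it is obtained by transport along the isomorphism intertwining the two universal quantum homomorphisms. Proposition. Let $$\mathcal U:=\underset{1\le\kappa\le K}{*}\,e^\kappa_{11}\big(A*M_{N_\kappa}(\mathbb C)\big)e^\kappa_{11},\qquad \rho(a):=\sum_{\kappa,i,j}e^\kappa_{ij}\otimes\nu_\kappa\big(e^\kappa_{1i}\,a\,e^\kappa_{j1}\big)\quad(a\in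 A),$$ where $\nu_\kappa:e^\kappa_{11}(A*M_{N_\kappa}(\mathbb C))e^\kappa_{11}\to\mathcal U$ is the canonical homomorphism of the $\kappa$-th factor. Then $\rho:A\to B\otimes\mathcal U$ is a unital $*$-homomorphism and it is the universal quantum homomorphism from $A$ to $B$. Moreover, for every state $\omega$ on $A$, the free product states $\varphi_\kappa=\omega*\mathrm{tr}_\kappa$ and the canonical state $\widetilde\omega$ on $\mathcal U$ exist and are unique, and $\widetilde\omega$ is the free product state $$\widetilde\omega=\underset{1\le\kappa\le K}{*}\varphi_\kappa^{e^\kappa_{11}}.$$ -/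

import Mathlib

open scoped TensorProduct NNReal ComplexOrder

noncomputable section

/-! ### Universal C*-algebras given by generators and relations -/

/-- The free unital complex `*`-algebra on a set `G` of letters carrying an involution: finite
formal combinations of words. -/
def FreeStarAlg (G : Type*) : Type _ := MonoidAlgebra ℂ (FreeMonoid G)

namespace FreeStarAlg

variable {G : Type*}

instance : Ring (FreeStarAlg G) := inferInstanceAs (Ring (MonoidAlgebra ℂ (FreeMonoid G)))

instance : Algebra ℂ (FreeStarAlg G) :=
  inferInstanceAs (Algebra ℂ (MonoidAlgebra ℂ (FreeMonoid G)))

/-- The scalar multiple `c • w` of a word `w`. -/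
def word (w : FreeMonoid G) (c : ℂ) : FreeStarAlg G := MonoidAlgebra.single w c

/-- A letter, as an element of the free `*`-algebra. -/
def gen (g : G) : FreeStarAlg G := word (FreeMonoid.of g) 1

theorem word_mul_word (v w : FreeMonoid G) (c d : ℂ) :
    word v c * word w d = word (v * w) (c * d) :=
  MonoidAlgebra.single_mul_single v w c d

theorem word_zero (w : FreeMonoid G) : word w 0 = 0 := MonoidAlgebra.single_zero w

theorem word_add (w : FreeMonoid G) (c d : ℂ) : word w (c + d) = word w c + word w d :=
  MonoidAlgebra.single_add w c d

theorem smul_word (r : ℂ) (w : FreeMonoid G) (c : ℂ) : r • word w c = word w (r * c) :=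
  MonoidAlgebra.smul_single r w c

theorem one_eq_word : (1 : FreeStarAlg G) = word 1 1 := MonoidAlgebra.one_def

theorem induction_word {motive : FreeStarAlg G → Prop} (x : FreeStarAlg G) (zero : motive 0)
    (add : ∀ x y, motive x → motive y → motive (x + y)) (single : ∀ w c, motive (word w c)) :
    motive x :=
  MonoidAlgebra.induction_linear x zero add single

variable [InvolutiveStar G]

/-- The adjoint of a word: reverse it and take the adjoint of each letter. -/
def wordStar (w : FreeMonoid G) : FreeMonoid G := star (FreeMonoid.map star w)

theorem wordStar_one : wordStar (1 : FreeMonoid G) = 1 := by simp [wordStar]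

theorem wordStar_of (g : G) : wordStar (FreeMonoid.of g) = FreeMonoid.of (star g) := by
  simp [wordStar]

theorem wordStar_mul (v w : FreeMonoid G) : wordStar (v * w) = wordStar w * wordStar v := by
  simp [wordStar]

theorem wordStar_wordStar (w : FreeMonoid G) : wordStar (wordStar w) = w := by
  induction w using FreeMonoid.inductionOn with
  | one => simp [wordStar_one]
  | of g => simp [wordStar_of]
  | mul v w hv hw => simp [wordStar_mul, hv, hw]

/-- The adjoint: conjugate-linear extension of `wordStar`. -/
def adj (x : FreeStarAlg G) : FreeStarAlg G :=
  (MonoidAlgebra.coeff x).sum fun w c => word (wordStar w) (star c)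

theorem adj_word (w : FreeMonoid G) (c : ℂ) : adj (word w c) = word (wordStar w) (star c) := by
  refine (Finsupp.sum_single_index ?_)
  simp [word_zero]

theorem adj_zero : adj (0 : FreeStarAlg G) = 0 := Finsupp.sum_zero_index

theorem adj_add (x y : FreeStarAlg G) : adj (x + y) = adj x + adj y :=
  Finsupp.sum_add_index' (by simp [word_zero]) (by simp [word_add])

theorem adj_adj (x : FreeStarAlg G) : adj (adj x) = x := by
  induction x using induction_word with
  | zero => simp [adj_zero]
  | add x y hx hy => simp [adj_add, hx, hy]
  | single w c => simp [adj_word, wordStar_wordStar]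

theorem adj_mul (x y : FreeStarAlg G) : adj (x * y) = adj y * adj x := by
  induction x using induction_word with
  | zero => simp [adj_zero]
  | add x y hx hy => simp [adj_add, hx, hy, add_mul, mul_add]
  | single w c =>
    induction y using induction_word with
    | zero => simp [adj_zero]
    | add x y hx hy => simp [adj_add, hx, hy, add_mul, mul_add]
    | single w c => simp [adj_word, word_mul_word, wordStar_mul, mul_comm]

instance : StarRing (FreeStarAlg G) where
  star := adj
  star_involutive := adj_adj
  star_mul := adj_mul
  star_add := adj_add

theorem star_word (w : FreeMonoid G) (c : ℂ) :
    star (word w c) = word (wordStar w) (star c) := adj_word w c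

theorem star_gen (g : G) : star (gen g) = gen (star g) := by
  simp [gen, star_word, wordStar_of]

instance : StarModule ℂ (FreeStarAlg G) where
  star_smul r x := by
    induction x using induction_word with
    | zero => simp
    | add x y hx hy => simp [hx, hy]
    | single w c => simp [smul_word, star_word]

end FreeStarAlg

section Universal

variable {G : Type*} [InvolutiveStar G]

/-- The C*-seminorms on the free `*`-algebra that are at most `b g` on each letter `g` and vanish
on the relators `R`. -/
structure IsAdmissible (b : G → ℝ≥0) (R : Set (FreeStarAlg G))
    (p : Seminorm ℂ (FreeStarAlg G)) : Prop where
  mul_le : ∀ x y, p (x * y) ≤ p x * p y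
  star_mul_self : ∀ x, p (star x * x) = p x ^ 2
  gen_le : ∀ g, p (FreeStarAlg.gen g) ≤ b g
  rel : ∀ r ∈ R, p r = 0

variable (b : G → ℝ≥0) (R : Set (FreeStarAlg G))

/-- The largest admissible C*-seminorm. -/
def maxSeminorm (x : FreeStarAlg G) : ℝ :=
  ⨆ p : {p : Seminorm ℂ (FreeStarAlg G) // IsAdmissible b R p}, p.1 x

theorem isAdmissible_zero : IsAdmissible b R 0 := by
  constructor <;> simp

instance : Nonempty {p : Seminorm ℂ (FreeStarAlg G) // IsAdmissible b R p} :=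
  ⟨0, isAdmissible_zero b R⟩

variable {b R}

theorem IsAdmissible.one_le {p : Seminorm ℂ (FreeStarAlg G)} (hp : IsAdmissible b R p) :
    p 1 ≤ 1 := by
  have h := hp.star_mul_self 1
  simp only [star_one, mul_one] at h
  nlinarith [apply_nonneg p (1 : FreeStarAlg G)]

theorem IsAdmissible.star_le {p : Seminorm ℂ (FreeStarAlg G)} (hp : IsAdmissible b R p)
    (x : FreeStarAlg G) : p (star x) ≤ p x := by
  have h1 := hp.star_mul_self (star x)
  have h2 := hp.mul_le (star (star x)) (star x)
  rw [h1, star_star] at h2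
  by_contra! h
  nlinarith [apply_nonneg p x, apply_nonneg p (star x)]

theorem exists_bound (x : FreeStarAlg G) : ∃ C : ℝ, ∀ p, IsAdmissible b R p → p x ≤ C := by
  induction x using FreeStarAlg.induction_word with
  | zero => exact ⟨0, fun p _ => by simp⟩
  | add x y hx hy =>
    obtain ⟨C, hC⟩ := hx
    obtain ⟨D, hD⟩ := hy
    exact ⟨C + D, fun p hp => (map_add_le_add p x y).trans (add_le_add (hC p hp) (hD p hp))⟩
  | single w c =>
    suffices h : ∃ C : ℝ, ∀ p, IsAdmissible b R p → p (FreeStarAlg.word w 1) ≤ C by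
      obtain ⟨C, hC⟩ := h
      refine ⟨‖c‖ * C, fun p hp => ?_⟩
      have : FreeStarAlg.word w c = c • FreeStarAlg.word w 1 := by simp [FreeStarAlg.smul_word]
      rw [this, map_smul_eq_mul]
      exact mul_le_mul_of_nonneg_left (hC p hp) (norm_nonneg c)
    induction w using FreeMonoid.inductionOn with
    | one => exact ⟨1, fun p hp => by simpa [FreeStarAlg.one_eq_word] using hp.one_le⟩
    | of g => exact ⟨b g, fun p hp => hp.gen_le g⟩
    | mul v w hv hw =>
      obtain ⟨C, hC⟩ := hv
      obtain ⟨D, hD⟩ := hw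
      refine ⟨C * D, fun p hp => ?_⟩
      have : FreeStarAlg.word (v * w) 1 = FreeStarAlg.word v 1 * FreeStarAlg.word w 1 := by
        simp [FreeStarAlg.word_mul_word]
      rw [this]
      exact (hp.mul_le _ _).trans (mul_le_mul (hC p hp) (hD p hp) (apply_nonneg p _)
        ((apply_nonneg p _).trans (hC p hp)))

theorem bddAbove_range (x : FreeStarAlg G) : BddAbove (Set.range
    fun p : {p : Seminorm ℂ (FreeStarAlg G) // IsAdmissible b R p} => p.1 x) := by
  obtain ⟨C, hC⟩ := exists_bound (b := b) (R := R) x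
  exact ⟨C, by rintro _ ⟨p, rfl⟩; exact hC p.1 p.2⟩

theorem IsAdmissible.le_max {p : Seminorm ℂ (FreeStarAlg G)} (hp : IsAdmissible b R p)
    (x : FreeStarAlg G) : p x ≤ maxSeminorm b R x :=
  le_ciSup (bddAbove_range x) (⟨p, hp⟩ : {p // IsAdmissible b R p})

theorem maxSeminorm_le {x : FreeStarAlg G} {C : ℝ} (h : ∀ p, IsAdmissible b R p → p x ≤ C) :
    maxSeminorm b R x ≤ C :=
  ciSup_le fun p => h p.1 p.2

theorem maxSeminorm_nonneg (x : FreeStarAlg G) : 0 ≤ maxSeminorm b R x :=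
  (isAdmissible_zero b R).le_max x

theorem maxSeminorm_zero : maxSeminorm b R 0 = 0 :=
  le_antisymm (maxSeminorm_le fun p _ => by simp) (maxSeminorm_nonneg 0)

theorem maxSeminorm_add_le (x y : FreeStarAlg G) :
    maxSeminorm b R (x + y) ≤ maxSeminorm b R x + maxSeminorm b R y :=
  maxSeminorm_le fun p hp =>
    (map_add_le_add p x y).trans (add_le_add (hp.le_max x) (hp.le_max y))

theorem maxSeminorm_neg (x : FreeStarAlg G) : maxSeminorm b R (-x) = maxSeminorm b R x := by
  simp [maxSeminorm, map_neg_eq_map]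

theorem maxSeminorm_smul_le (c : ℂ) (x : FreeStarAlg G) :
    maxSeminorm b R (c • x) ≤ ‖c‖ * maxSeminorm b R x :=
  maxSeminorm_le fun p hp => by
    rw [map_smul_eq_mul]
    exact mul_le_mul_of_nonneg_left (hp.le_max x) (norm_nonneg c)

theorem maxSeminorm_mul_le (x y : FreeStarAlg G) :
    maxSeminorm b R (x * y) ≤ maxSeminorm b R x * maxSeminorm b R y :=
  maxSeminorm_le fun p hp => (hp.mul_le x y).trans
    (mul_le_mul (hp.le_max x) (hp.le_max y) (apply_nonneg p y) (maxSeminorm_nonneg x))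

theorem maxSeminorm_star_le (x : FreeStarAlg G) :
    maxSeminorm b R (star x) ≤ maxSeminorm b R x :=
  maxSeminorm_le fun _ hp => (hp.star_le x).trans (hp.le_max x)

theorem maxSeminorm_mul_self_le (x : FreeStarAlg G) :
    maxSeminorm b R x * maxSeminorm b R x ≤ maxSeminorm b R (star x * x) := by
  have h : maxSeminorm b R x ≤ √(maxSeminorm b R (star x * x)) := by
    refine maxSeminorm_le fun p hp => Real.le_sqrt_of_sq_le ?_
    rw [← hp.star_mul_self]
    exact hp.le_max _
  calc _ ≤ √(maxSeminorm b R (star x * x)) * √(maxSeminorm b R (star x * x)) :=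
        mul_self_le_mul_self (maxSeminorm_nonneg x) h
    _ = _ := Real.mul_self_sqrt (maxSeminorm_nonneg _)

variable (b R)

/-- The free `*`-algebra, equipped with the largest admissible C*-seminorm. -/
def PreUnivCStar (_b : G → ℝ≥0) (_R : Set (FreeStarAlg G)) : Type _ := FreeStarAlg G

namespace PreUnivCStar

instance : Ring (PreUnivCStar b R) := inferInstanceAs (Ring (FreeStarAlg G))

instance : StarRing (PreUnivCStar b R) := inferInstanceAs (StarRing (FreeStarAlg G))

instance : Algebra ℂ (PreUnivCStar b R) := inferInstanceAs (Algebra ℂ (FreeStarAlg G))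

instance : StarModule ℂ (PreUnivCStar b R) := inferInstanceAs (StarModule ℂ (FreeStarAlg G))

instance : SeminormedRing (PreUnivCStar b R) where
  norm := fun x : FreeStarAlg G => maxSeminorm b R x
  dist := fun x y : FreeStarAlg G => maxSeminorm b R (-x + y)
  dist_self := fun x : FreeStarAlg G => by
    rw [neg_add_cancel, maxSeminorm_zero]
  dist_comm := fun x y : FreeStarAlg G => by
    rw [← maxSeminorm_neg]
    congr 1
    abel
  dist_triangle := fun x y z : FreeStarAlg G => by
    refine le_trans (le_of_eq ?_) (maxSeminorm_add_le _ _)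
    congr 1
    abel
  dist_eq _ _ := rfl
  norm_mul_le x y := maxSeminorm_mul_le (b := b) (R := R) (show FreeStarAlg G from x) y

instance : NormedAlgebra ℂ (PreUnivCStar b R) where
  norm_smul_le c x := maxSeminorm_smul_le (b := b) (R := R) c (show FreeStarAlg G from x)

theorem norm_star_le (x : PreUnivCStar b R) : ‖star x‖ ≤ ‖x‖ :=
  maxSeminorm_star_le (b := b) (R := R) (show FreeStarAlg G from x)

theorem norm_mul_self_le (x : PreUnivCStar b R) : ‖x‖ * ‖x‖ ≤ ‖star x * x‖ :=
  maxSeminorm_mul_self_le (b := b) (R := R) (show FreeStarAlg G from x)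

theorem uniformContinuous_star : UniformContinuous (star : PreUnivCStar b R → PreUnivCStar b R) :=
  (AddMonoidHomClass.lipschitz_of_bound
    (starAddEquiv : PreUnivCStar b R ≃+ PreUnivCStar b R).toAddMonoidHom 1
    fun x => by simpa using norm_star_le b R x).uniformContinuous

end PreUnivCStar

/-- The universal unital C*-algebra generated by letters `g ∈ G` of norm at most `b g` (the adjoint
of the letter `g` being the letter `star g`), subject to the relations `r = 0`, `r ∈ R`: the
Hausdorff completion of the free `*`-algebra for its largest admissible C*-seminorm. -/
def UnivCStar : Type _ := UniformSpace.Completion (PreUnivCStar b R)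

namespace UnivCStar

open UniformSpace

instance : NormedRing (UnivCStar b R) :=
  inferInstanceAs (NormedRing (Completion (PreUnivCStar b R)))

instance : CompleteSpace (UnivCStar b R) :=
  inferInstanceAs (CompleteSpace (Completion (PreUnivCStar b R)))

instance : Algebra ℂ (UnivCStar b R) :=
  inferInstanceAs (Algebra ℂ (Completion (PreUnivCStar b R)))

instance : NormedAlgebra ℂ (UnivCStar b R) where
  norm_smul_le c x := by
    exact norm_smul_le (α := ℂ) (β := Completion (PreUnivCStar b R)) c x

variable {b R}

/-- The class of an element of the free `*`-algebra. -/
def mk (x : FreeStarAlg G) : UnivCStar b R :=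
  Completion.coe' (α := PreUnivCStar b R) x

theorem continuous_mk : Continuous fun x : PreUnivCStar b R => (mk x : UnivCStar b R) :=
  Completion.continuous_coe _

theorem mk_induction {motive : UnivCStar b R → Prop} (x : UnivCStar b R)
    (closed : IsClosed {x | motive x}) (mk : ∀ x, motive (mk x)) : motive x :=
  Completion.induction_on x closed mk

theorem mk_add (x y : FreeStarAlg G) : (mk (x + y) : UnivCStar b R) = mk x + mk y :=
  Completion.coe_add (α := PreUnivCStar b R) x y

theorem mk_sub (x y : FreeStarAlg G) : (mk (x - y) : UnivCStar b R) = mk x - mk y :=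
  Completion.coe_sub (α := PreUnivCStar b R) x y

theorem mk_mul (x y : FreeStarAlg G) : (mk (x * y) : UnivCStar b R) = mk x * mk y :=
  Completion.coe_mul (α := PreUnivCStar b R) x y

theorem mk_one : (mk 1 : UnivCStar b R) = 1 :=
  Completion.coe_one (PreUnivCStar b R)

theorem mk_smul (c : ℂ) (x : FreeStarAlg G) : (mk (c • x) : UnivCStar b R) = c • mk x :=
  Completion.coe_smul (X := PreUnivCStar b R) c x

theorem norm_mk (x : FreeStarAlg G) : ‖(mk x : UnivCStar b R)‖ = maxSeminorm b R x :=
  Completion.norm_coe (E := PreUnivCStar b R) x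

theorem mk_eq_zero {r : FreeStarAlg G} (hr : r ∈ R) : (mk r : UnivCStar b R) = 0 := by
  rw [← norm_eq_zero, norm_mk]
  exact le_antisymm (maxSeminorm_le fun p hp => (hp.rel r hr).le) (maxSeminorm_nonneg r)

/-- The adjoint, extended by continuity. -/
def adj (x : UnivCStar b R) : UnivCStar b R :=
  Completion.map (star : PreUnivCStar b R → PreUnivCStar b R) x

theorem continuous_adj : Continuous (adj : UnivCStar b R → UnivCStar b R) :=
  Completion.continuous_map

theorem adj_mk (x : FreeStarAlg G) : adj (mk x : UnivCStar b R) = mk (star x) :=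
  Completion.map_coe (PreUnivCStar.uniformContinuous_star b R) x

instance : StarRing (UnivCStar b R) where
  star := adj
  star_involutive x := by
    induction x using mk_induction with
    | closed => exact isClosed_eq (continuous_adj.comp continuous_adj) continuous_id
    | mk x => rw [adj_mk, adj_mk, star_star]
  star_mul x y := by
    change adj (x * y) = adj y * adj x
    induction x using mk_induction with
    | closed =>
      exact isClosed_eq (continuous_adj.comp (continuous_mul_const y))
        (continuous_const.mul continuous_adj)
    | mk x =>
      induction y using mk_induction with
      | closed =>
        exact isClosed_eq (continuous_adj.comp (continuous_const_mul _))
          (continuous_adj.mul continuous_const)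
      | mk y => rw [← mk_mul, adj_mk, adj_mk, adj_mk, star_mul, mk_mul]
  star_add x y := by
    change adj (x + y) = adj x + adj y
    induction x using mk_induction with
    | closed =>
      exact isClosed_eq (continuous_adj.comp (continuous_add_const y))
        (continuous_adj.add continuous_const)
    | mk x =>
      induction y using mk_induction with
      | closed =>
        exact isClosed_eq (continuous_adj.comp (continuous_const_add _))
          (continuous_const.add continuous_adj)
      | mk y => rw [← mk_add, adj_mk, adj_mk, adj_mk, star_add, mk_add]

theorem star_mk (x : FreeStarAlg G) : star (mk x : UnivCStar b R) = mk (star x) := adj_mk x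

theorem continuous_star' : Continuous (star : UnivCStar b R → UnivCStar b R) := continuous_adj

instance : CStarRing (UnivCStar b R) where
  norm_mul_self_le x := by
    induction x using mk_induction with
    | closed =>
      exact isClosed_le (continuous_norm.mul continuous_norm)
        (continuous_norm.comp (continuous_star'.mul continuous_id))
    | mk x =>
      rw [star_mk, ← mk_mul, norm_mk, norm_mk]
      exact maxSeminorm_mul_self_le x

instance : StarModule ℂ (UnivCStar b R) where
  star_smul c x := by
    induction x using mk_induction with
    | closed =>
      exact isClosed_eq (continuous_star'.comp (continuous_const_smul c))
        ((continuous_const_smul (star c)).comp continuous_star')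
    | mk x => rw [← mk_smul, star_mk, star_mk, star_smul, mk_smul]

instance : CStarAlgebra (UnivCStar b R) where

end UnivCStar

end Universal

/-! ### Full free products of unital C*-algebras -/

section FreeProducts

universe u v

/-- For a map `j` from a unital C*-algebra `D` to the letters: the relators expressing that `j` is
a homomorphism of unital complex algebras. -/
inductive IsHomRelator {G : Type*} {D : Type*} [CStarAlgebra D] (j : D → G) : FreeStarAlg G → Prop
  | add (a b : D) : IsHomRelator j (.gen (j (a + b)) - (.gen (j a) + .gen (j b)))
  | mul (a b : D) : IsHomRelator j (.gen (j (a * b)) - .gen (j a) * .gen (j b))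
  | smul (c : ℂ) (a : D) : IsHomRelator j (.gen (j (c • a)) - c • .gen (j a))
  | one : IsHomRelator j (.gen (j 1) - 1)

/-- The `*`-homomorphism given by a letter map whose homomorphism relators hold. -/
def UnivCStar.ofLetters {G : Type*} [InvolutiveStar G] {b : G → ℝ≥0} {R : Set (FreeStarAlg G)}
    {D : Type*} [CStarAlgebra D] (j : D → G) (hstar : ∀ a, j (star a) = star (j a))
    (hj : ∀ r, IsHomRelator j r → r ∈ R) : D →⋆ₐ[ℂ] UnivCStar b R where
  __ := AlgHom.ofLinearMap
    { toFun := fun a => (mk (.gen (j a)) : UnivCStar b R)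
      map_add' := fun a c => by
        rw [← mk_add, ← sub_eq_zero, ← mk_sub]
        exact mk_eq_zero (hj _ (.add a c))
      map_smul' := fun c a => by
        rw [RingHom.id_apply, ← mk_smul, ← sub_eq_zero, ← mk_sub]
        exact mk_eq_zero (hj _ (.smul c a)) }
    (by
      change (mk (.gen (j 1)) : UnivCStar b R) = 1
      rw [← mk_one, ← sub_eq_zero, ← mk_sub]
      exact mk_eq_zero (hj _ .one))
    (fun a c => by
      change (mk (.gen (j (a * c))) : UnivCStar b R) = mk (.gen (j a)) * mk (.gen (j c))
      rw [← mk_mul, ← sub_eq_zero, ← mk_sub]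
      exact mk_eq_zero (hj _ (.mul a c)))
  map_star' a := by
    change (mk (.gen (j (star a))) : UnivCStar b R) = star (mk (.gen (j a)))
    rw [star_mk, FreeStarAlg.star_gen, hstar]

/-- Letters for the free product of a family. -/
inductive FamLetter {ι : Type u} (C : ι → Type v) : Type (max u v)
  | of (i : ι) (a : C i) : FamLetter C

/-- Letters for the free product of two algebras. -/
inductive PairLetter (A : Type u) (D : Type v) : Type (max u v)
  | inl (a : A) : PairLetter A D
  | inr (d : D) : PairLetter A D

section Family

variable {ι : Type u} (C : ι → Type v) [∀ i, CStarAlgebra (C i)]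

instance : InvolutiveStar (FamLetter C) where
  star | .of i a => .of i (star a)
  star_involutive | .of i a => by simp

/-- The full (unital) free product of a family of unital C*-algebras: the universal unital
C*-algebra containing unital `*`-homomorphic images of all of them. -/
abbrev FreeProd : Type (max u v) :=
  UnivCStar (fun g : FamLetter C => match g with | .of _ a => ‖a‖₊)
    {r | ∃ i, IsHomRelator (FamLetter.of (C := C) i) r}

/-- The canonical `*`-homomorphism from a factor to the free product. -/
def FreeProd.of (i : ι) : C i →⋆ₐ[ℂ] FreeProd C :=
  UnivCStar.ofLetters (FamLetter.of i) (fun _ => rfl) (fun _ hr => ⟨i, hr⟩)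

end Family

section Pair

variable (A : Type u) (D : Type v) [CStarAlgebra A] [CStarAlgebra D]

instance : InvolutiveStar (PairLetter A D) where
  star
    | .inl a => .inl (star a)
    | .inr d => .inr (star d)
  star_involutive
    | .inl a => by simp
    | .inr d => by simp

/-- The full (unital) free product `A * D` of two unital C*-algebras. -/
abbrev FreeProd₂ : Type (max u v) :=
  UnivCStar
    (fun g : PairLetter A D => match g with
      | .inl a => ‖a‖₊
      | .inr d => ‖d‖₊)
    {r | IsHomRelator (PairLetter.inl (A := A) (D := D)) r ∨
      IsHomRelator (PairLetter.inr (A := A) (D := D)) r}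

/-- The canonical `*`-homomorphism `A → A * D`. -/
def FreeProd₂.inl : A →⋆ₐ[ℂ] FreeProd₂ A D :=
  UnivCStar.ofLetters PairLetter.inl (fun _ => rfl) (fun _ hr => .inl hr)

/-- The canonical `*`-homomorphism `D → A * D`. -/
def FreeProd₂.inr : D →⋆ₐ[ℂ] FreeProd₂ A D :=
  UnivCStar.ofLetters PairLetter.inr (fun _ => rfl) (fun _ hr => .inr hr)

end Pair

end FreeProducts

/-! ### Compressions -/

section Corner

variable {P : Type*} [CStarAlgebra P]

/-- `pPp`, as a non-unital `*`-subalgebra of `P`. -/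
def cornerSubalgebra (p : P) (hp : IsStarProjection p) : NonUnitalStarSubalgebra ℂ P where
  carrier := {x | p * x = x ∧ x * p = x}
  add_mem' := fun hx hy => ⟨by rw [mul_add, hx.1, hy.1], by rw [add_mul, hx.2, hy.2]⟩
  zero_mem' := by simp
  mul_mem' := fun hx hy => ⟨by rw [← mul_assoc, hx.1], by rw [mul_assoc, hy.2]⟩
  smul_mem' := fun c x hx => ⟨by rw [mul_smul_comm, hx.1], by rw [smul_mul_assoc, hx.2]⟩
  star_mem' := fun {x} hx => by
    have h := hp.isSelfAdjoint.star_eq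
    refine ⟨?_, ?_⟩
    · conv_rhs => rw [← hx.2, star_mul, h]
    · conv_rhs => rw [← hx.1, star_mul, h]

/-- The corner `pPp` of a unital C*-algebra `P` at a projection `p`: a unital C*-algebra with
unit `p`. -/
def Corner (p : P) (hp : IsStarProjection p) : Type _ := cornerSubalgebra p hp

namespace Corner

variable (p : P) (hp : IsStarProjection p)

instance isClosed : IsClosed (cornerSubalgebra p hp : Set P) := by
  have : (cornerSubalgebra p hp : Set P) = {x | p * x = x} ∩ {x | x * p = x} := rfl
  rw [this]
  exact (isClosed_eq (continuous_const_mul p) continuous_id).inter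
    (isClosed_eq (continuous_mul_const p) continuous_id)

instance : NonUnitalCStarAlgebra (Corner p hp) :=
  inferInstanceAs (NonUnitalCStarAlgebra (cornerSubalgebra p hp))

/-- The inclusion `pPp → P`. -/
def incl : Corner p hp →ₗ[ℂ] P where
  toFun x := x.1
  map_add' _ _ := rfl
  map_smul' _ _ := rfl

instance : NormedRing (Corner p hp) where
  __ := (inferInstance : NonUnitalNormedRing (Corner p hp))
  one := ⟨p, hp.isIdempotentElem, hp.isIdempotentElem⟩
  one_mul x := Subtype.ext x.2.1
  mul_one x := Subtype.ext x.2.2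

instance : NormedAlgebra ℂ (Corner p hp) where
  __ := Algebra.ofModule (R := ℂ) (A := Corner p hp) smul_mul_assoc mul_smul_comm
  norm_smul_le := norm_smul_le

instance : CStarAlgebra (Corner p hp) where

end Corner

end Corner

/-! ### States and freeness -/

/-- A state of a unital C*-algebra: a unital positive linear functional. -/
def IsState {P : Type*} [CStarAlgebra P] (φ : P →ₗ[ℂ] ℂ) : Prop :=
  φ 1 = 1 ∧ ∀ x, 0 ≤ φ (star x * x)

/-- Freeness of a family of unital `*`-subalgebras with respect to a functional `φ`: `φ` vanishes
on `x₀ x₁ ⋯ xₙ` whenever the factors are `φ`-centred and consecutive factors are taken from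
subalgebras with different indices. -/
def AreFree {ι P : Type*} [CStarAlgebra P] (φ : P →ₗ[ℂ] ℂ) (S : ι → StarSubalgebra ℂ P) : Prop :=
  ∀ (n : ℕ) (i : Fin (n + 1) → ι) (x : Fin (n + 1) → P),
    (∀ k, x k ∈ S (i k)) → (∀ k, φ (x k) = 0) →
    (∀ k : Fin n, i k.castSucc ≠ i k.succ) → φ (List.ofFn x).prod = 0

/-- `φ` is the free product `*ᵢ ωᵢ` of the states `ωᵢ`. -/
structure IsFreeProductState {ι : Type*} {C : ι → Type*} [∀ i, CStarAlgebra (C i)]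
    (ω : ∀ i, C i →ₗ[ℂ] ℂ) (φ : FreeProd C →ₗ[ℂ] ℂ) : Prop where
  isState : IsState φ
  of : ∀ i a, φ (FreeProd.of C i a) = ω i a
  free : AreFree φ fun i => (FreeProd.of C i).range

/-- `φ` is the free product `ω * τ` of the states `ω` and `τ`. -/
structure IsFreeProductState₂ {A D : Type*} [CStarAlgebra A] [CStarAlgebra D]
    (ω : A →ₗ[ℂ] ℂ) (τ : D →ₗ[ℂ] ℂ) (φ : FreeProd₂ A D →ₗ[ℂ] ℂ) : Prop where
  isState : IsState φ
  inl : ∀ a, φ (FreeProd₂.inl A D a) = ω a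
  inr : ∀ d, φ (FreeProd₂.inr A D d) = τ d
  free : AreFree φ fun s : Bool =>
    if s then (FreeProd₂.inl A D).range else (FreeProd₂.inr A D).range

/-- The compression `φᵖ = φ(p)⁻¹ φ|_{pPp}`. -/
def compress {P : Type*} [CStarAlgebra P] (φ : P →ₗ[ℂ] ℂ) (p : P) (hp : IsStarProjection p) :
    Corner p hp →ₗ[ℂ] ℂ :=
  (φ p)⁻¹ • φ ∘ₗ Corner.incl p hp

/-! ### Matrix algebras and quantum homomorphisms -/

/-- The C*-algebra `M_n(ℂ)`. -/
abbrev Mat (n : ℕ) : Type := CStarMatrix (Fin n) (Fin n) ℂ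

namespace Mat

variable {n : ℕ}

/-- The matrix unit `e_{ij}`. -/
def e (i j : Fin n) : Mat n := CStarMatrix.ofMatrix (Matrix.single i j 1)

theorem e_mul_e (i j l : Fin n) : e i j * e j l = e i l := by
  have h : Matrix.single i j (1 : ℂ) * Matrix.single j l 1 = Matrix.single i l 1 := by simp
  exact h

theorem e_mul_e_of_ne {i j k l : Fin n} (h : j ≠ k) : e i j * e k l = 0 := by
  have h : Matrix.single i j (1 : ℂ) * Matrix.single k l 1 = 0 := by simp [h]
  exact h

theorem eq_sum_e (m : Mat n) : m = ∑ i, ∑ j, m i j • e i j := by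
  have h := Matrix.matrix_eq_sum_single (m : Matrix (Fin n) (Fin n) ℂ)
  refine h.trans ?_
  refine Finset.sum_congr rfl fun i _ => Finset.sum_congr rfl fun j _ => ?_
  have h : Matrix.single i j (m i j) = m i j • Matrix.single i j (1 : ℂ) := by simp
  exact h

theorem star_e (i j : Fin n) : star (e i j) = e j i := by
  have h : (Matrix.single i j (1 : ℂ)).conjTranspose = Matrix.single j i 1 := by simp
  exact h

/-- The normalised trace on `M_n(ℂ)`. -/
def tr (n : ℕ) : Mat n →ₗ[ℂ] ℂ where
  toFun m := (n : ℂ)⁻¹ * ∑ i, m i i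
  map_add' x y := by simp [Finset.sum_add_distrib, mul_add]
  map_smul' c x := by simp [← Finset.mul_sum, mul_left_comm]

end Mat

/-- The finite-dimensional C*-algebra `B = ⨁_κ M_{N κ}(ℂ)`. -/
abbrev DirectSumMat {K : ℕ} (N : Fin K → ℕ) : Type := ∀ κ, Mat (N κ)

/-- The matrix unit `e^κ_{ij}` of `⨁_κ M_{N κ}(ℂ)`. -/
def DirectSumMat.e {K : ℕ} (N : Fin K → ℕ) (κ : Fin K) (i j : Fin (N κ)) : DirectSumMat N :=
  Pi.single κ (Mat.e i j)

/-- `ρ : A → B ⊗ U` is the universal quantum homomorphism from `A` to `B = ⨁_κ M_{N κ}(ℂ)`. As `B`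
is finite dimensional, the algebraic tensor product `B ⊗ U` is the C*-algebraic one. -/
def IsUniversalQuantumHom.{u, w, v} {A : Type u} {U : Type w} [CStarAlgebra A] [CStarAlgebra U]
    {K : ℕ} {N : Fin K → ℕ} (ρ : A →⋆ₐ[ℂ] DirectSumMat N ⊗[ℂ] U) : Prop :=
  ∀ (U' : Type v) [CStarAlgebra U'] (ρ' : A →⋆ₐ[ℂ] DirectSumMat N ⊗[ℂ] U'),
    ∃! π : U →⋆ₐ[ℂ] U', ∀ a,
      Algebra.TensorProduct.map (AlgHom.id ℂ (DirectSumMat N)) π.toAlgHom (ρ a) = ρ' a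

section Constructions

variable (A : Type*) [CStarAlgebra A]

/-- The full free product `A * M_n(ℂ)`. -/
abbrev FreeMat (n : ℕ) : Type _ := FreeProd₂ A (Mat n)

namespace FreeMat

variable {n : ℕ}

/-- The matrix unit `e_{ij}` in `A * M_n(ℂ)`. -/
def e (i j : Fin n) : FreeMat A n := FreeProd₂.inr A (Mat n) (Mat.e i j)

theorem e_mul_e (i j l : Fin n) : e A i j * e A j l = e A i l := by
  rw [e, e, ← map_mul, Mat.e_mul_e, e]

theorem e_mul_e_of_ne {i j k l : Fin n} (h : j ≠ k) : e A i j * e A k l = 0 := by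
  rw [e, e, ← map_mul, Mat.e_mul_e_of_ne h, map_zero]

theorem e_mul_e_mul (i j l : Fin n) (x : FreeMat A n) : e A i j * (e A j l * x) = e A i l * x := by
  rw [← mul_assoc, e_mul_e]

theorem isStarProjection_e (i : Fin n) : IsStarProjection (e A i i) :=
  ⟨e_mul_e A i i i, by rw [IsSelfAdjoint, e, ← map_star, Mat.star_e]⟩

variable {A}

/-- An element of `A`, viewed in `A * M_n(ℂ)`. -/
abbrev of (n : ℕ) (a : A) : FreeMat A n := FreeProd₂.inl A (Mat n) a

variable (A) (n) [NeZero n]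

/-- The corner `e₁₁ (A * M_n(ℂ)) e₁₁`. -/
abbrev Corner₁₁ : Type _ := Corner (e A (0 : Fin n) 0) (isStarProjection_e A 0)

variable {A n}

/-- The element `e_{1i} a e_{j1}` of the corner `e₁₁ (A * M_n(ℂ)) e₁₁`. -/
def cornerCoeff (i j : Fin n) (a : A) : Corner₁₁ A n :=
  ⟨e A 0 i * of n a * e A j 0, by simp only [mul_assoc, e_mul_e_mul],
    by simp only [mul_assoc, e_mul_e]⟩

end FreeMat

variable {K : ℕ} (N : Fin K → ℕ)

/-- `*_κ e^κ₁₁ (A * M_{N κ}(ℂ)) e^κ₁₁`. -/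
abbrev CornerFreeProd [∀ κ, NeZero (N κ)] : Type _ :=
  FreeProd fun κ => FreeMat.Corner₁₁ A (N κ)

/-! ### The canonical state -/

/-- The relative commutant `M_n(ℂ)' ∩ (A * M_n(ℂ))`. -/
def relCommutant (n : ℕ) : StarSubalgebra ℂ (FreeMat A n) :=
  StarSubalgebra.centralizer ℂ (Set.range (FreeProd₂.inr A (Mat n)))

instance (n : ℕ) : IsClosed (relCommutant A n : Set (FreeMat A n)) := by
  rw [relCommutant, StarSubalgebra.coe_centralizer]
  exact Set.isClosed_centralizer _

variable {A} in
/-- The element `ν_{ij}(a) = ∑_r e_{ri} a e_{jr}` of `M_n(ℂ)' ∩ (A * M_n(ℂ))`. -/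
def commCoeff {n : ℕ} (i j : Fin n) (a : A) : relCommutant A n :=
  ⟨∑ r, FreeMat.e A r i * FreeMat.of n a * FreeMat.e A j r, by
    rw [relCommutant, StarSubalgebra.mem_centralizer_iff]
    have key : ∀ m : Mat n, Commute (FreeProd₂.inr A (Mat n) m)
        (∑ r, FreeMat.e A r i * FreeMat.of n a * FreeMat.e A j r) := by
      intro m
      rw [Mat.eq_sum_e m, map_sum]
      refine Commute.sum_left _ _ _ fun k _ => ?_
      rw [map_sum]
      refine Commute.sum_left _ _ _ fun l _ => ?_
      rw [map_smul]
      refine Commute.smul_left ?_ _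
      change FreeMat.e A k l * _ = _ * FreeMat.e A k l
      rw [Finset.mul_sum, Finset.sum_mul, Finset.sum_eq_single l, Finset.sum_eq_single k]
      · simp only [mul_assoc, FreeMat.e_mul_e, FreeMat.e_mul_e_mul]
      · intro r _ hr
        rw [mul_assoc, FreeMat.e_mul_e_of_ne A hr, mul_zero]
      · simp
      · intro r _ hr
        rw [← mul_assoc, ← mul_assoc, FreeMat.e_mul_e_of_ne A hr.symm, zero_mul, zero_mul]
      · simp
    rintro _ ⟨m, rfl⟩
    refine ⟨key m, ?_⟩
    rw [← map_star]
    exact key (star m)⟩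

/-- `*_κ (M_{N κ}(ℂ)' ∩ (A * M_{N κ}(ℂ)))`. -/
abbrev CommutantFreeProd : Type _ := FreeProd fun κ => relCommutant A (N κ)

variable {A}

/-- The element `∑_{κ,i,j} e^κ_{ij} ⊗ ν^κ_{ij}(a)` of `B ⊗ *_κ (M_{N κ}(ℂ)' ∩ (A * M_{N κ}(ℂ)))`. -/
def commutantCoaction (a : A) : DirectSumMat N ⊗[ℂ] CommutantFreeProd A N :=
  ∑ κ, ∑ i, ∑ j, DirectSumMat.e N κ i j ⊗ₜ[ℂ]
    FreeProd.of (fun κ => relCommutant A (N κ)) κ (commCoeff i j a)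

variable {N}

/-- `ψ` is the canonical state on `U` associated with the state `ω` of `A`, where
`ρ : A → B ⊗ U` is a universal quantum homomorphism. By definition, the canonical state lives on
`*_κ (M_{N κ}(ℂ)' ∩ (A * M_{N κ}(ℂ)))`, with the universal quantum homomorphism
`a ↦ ∑ e^κ_{ij} ⊗ ν^κ_{ij}(a)`, where it is the free product over `κ` of the restrictions of the
states `ω * tr_κ` to the relative commutants; it is carried to `U` by the isomorphism `Θ` which
intertwines the two universal quantum homomorphisms. -/
def IsCanonicalState {U : Type*} [CStarAlgebra U] (ω : A →ₗ[ℂ] ℂ)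
    (ρ : A →⋆ₐ[ℂ] DirectSumMat N ⊗[ℂ] U) (ψ : U →ₗ[ℂ] ℂ) : Prop :=
  ∃ (Θ : CommutantFreeProd A N ≃⋆ₐ[ℂ] U) (φ : ∀ κ, FreeMat A (N κ) →ₗ[ℂ] ℂ),
    (∀ a, Algebra.TensorProduct.map (AlgHom.id ℂ (DirectSumMat N))
      (Θ : CommutantFreeProd A N →⋆ₐ[ℂ] U).toAlgHom (commutantCoaction N a) = ρ a) ∧
    (∀ κ, IsFreeProductState₂ ω (Mat.tr (N κ)) (φ κ)) ∧
    IsFreeProductState (fun κ => φ κ ∘ₗ (relCommutant A (N κ)).subtype.toAlgHom.toLinearMap)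
      (ψ ∘ₗ (Θ : CommutantFreeProd A N →⋆ₐ[ℂ] U).toAlgHom.toLinearMap)

end Constructions

end

universe u v

/-! The universal property reduces to matrices over the target. Since `B` is a direct sum of matrix
algebras, a homomorphism `A → B ⊗ U'` is a family of homomorphisms `A → M_{N κ}(U')`, one for each
`κ`. Together with the scalar matrices, each extends to `A * M_{N κ}(ℂ) → M_{N κ}(U')` preserving
matrix units, and its corner entry, restricted to the corner, is a homomorphism to `U'` (`ofMat`).
These assemble over the free product. Conversely a homomorphism `η` on the corner induces `x ↦ (η
(e_{1i} x e_{j1}))` on `A * M_n(ℂ)` (`toMat`), which is determined by its values on `A` and on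
matrix units. Hence `η` is determined on the elements `e_{1i} a e_{j1}` (`corner_hom_ext`), which
gives uniqueness. In the code the index `1` of the corner is `0 : Fin n`.

Free product states exist because GNS representations, with the cyclic vector as a basis vector, act
on the `ℓ²` space of reduced words, and the vacuum state there makes them free (`areFree_vacuum`).
They are unique because reduced words in centred elements span a dense subspace, on which freeness
fixes every value (`UnivCStar.state_eq_of_areFree`).

For the canonical state, `y ↦ e₁₁ y` is an isomorphism from the relative commutant to the corner,
with inverse `x ↦ ∑ e_{r1} x e_{1r}`, and it carries `ν_{ij}(a)` to `e_{1i} a e_{j1}`. It therefore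
induces the only isomorphism intertwining the two models (`eq_commutantFreeProdEquiv`). As `tr` is a
trace, `M_n(ℂ)` lies in the centralizer of `φ = ω * tr` (`IsFreeProductState₂.apply_inr_mul`). So `φ
(e_{rr} y)` does not depend on `r`, and `φ y = n φ (e₁₁ y)`, which is the compressed state of `e₁₁
y` (`compress_commutantEquivCorner`). Free product states correspond along this isomorphism. -/

/-! ### The universal property of full free products -/

section Lift

variable {G : Type*} {Q : Type*} [CStarAlgebra Q]

/-- The unital homomorphism on the free `*`-algebra prescribed on the letters. -/
noncomputable def FreeStarAlg.lift (f : G → Q) : FreeStarAlg G →ₐ[ℂ] Q :=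
  MonoidAlgebra.lift ℂ Q (FreeMonoid G) (FreeMonoid.lift f)

theorem FreeStarAlg.lift_word (f : G → Q) (w : FreeMonoid G) (c : ℂ) :
    lift f (word w c) = c • FreeMonoid.lift f w :=
  MonoidAlgebra.lift_single _ _ _

theorem FreeStarAlg.lift_gen (f : G → Q) (g : G) : lift f (gen g) = f g := by
  simp [gen, lift_word]

/-- A letter map given by a `*`-homomorphism kills the homomorphism relators. -/
theorem FreeStarAlg.lift_isHomRelator {D : Type*} [CStarAlgebra D] {f : G → Q} {j : D → G}
    (π : D →⋆ₐ[ℂ] Q) (h : ∀ a, f (j a) = π a) {r : FreeStarAlg G} (hr : IsHomRelator j r) :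
    lift f r = 0 := by
  cases hr <;> simp [lift_gen, h]

variable [InvolutiveStar G]

theorem FreeStarAlg.lift_star {f : G → Q} (hf : ∀ g, f (star g) = star (f g))
    (x : FreeStarAlg G) : lift f (star x) = star (lift f x) := by
  induction x using induction_word with
  | zero => simp
  | add x y hx hy => simp [hx, hy]
  | single w c =>
    rw [star_word, lift_word, lift_word, star_smul]
    congr 1
    induction w using FreeMonoid.inductionOn with
    | one => simp [wordStar_one]
    | of g => simp [wordStar_of, hf]
    | mul v w hv hw => simp [wordStar_mul, hv, hw]

variable {b : G → ℝ≥0} {R : Set (FreeStarAlg G)}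

/-- The pulled-back norm `x ↦ ‖lift f x‖` is itself an admissible C*-seminorm, hence lies below the
largest one. -/
theorem FreeStarAlg.norm_lift_le {f : G → Q} (hf : ∀ g, f (star g) = star (f g))
    (hb : ∀ g, ‖f g‖ ≤ b g) (hR : ∀ r ∈ R, lift f r = 0) (x : FreeStarAlg G) :
    ‖lift f x‖ ≤ maxSeminorm b R x := by
  let p : Seminorm ℂ (FreeStarAlg G) := (normSeminorm ℂ Q).comp (lift f).toLinearMap
  have hp : ∀ x, p x = ‖lift f x‖ := fun _ => rfl
  have : IsAdmissible b R p := by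
    refine ⟨fun x y => ?_, fun x => ?_, fun g => ?_, fun r hr => ?_⟩
    · simp only [hp, map_mul]
      exact norm_mul_le _ _
    · simp only [hp, map_mul, lift_star hf]
      rw [CStarRing.norm_star_mul_self, sq]
    · rw [hp, lift_gen]
      exact hb g
    · rw [hp, hR r hr, norm_zero]
  exact this.le_max x

theorem PreUnivCStar.continuous_lift {f : G → Q} (hf : ∀ g, f (star g) = star (f g))
    (hb : ∀ g, ‖f g‖ ≤ b g) (hR : ∀ r ∈ R, FreeStarAlg.lift f r = 0) :
    Continuous fun x : PreUnivCStar b R => (FreeStarAlg.lift f x : Q) := by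
  refine AddMonoidHomClass.continuous_of_bound
    (AddMonoidHom.mk' (fun x : PreUnivCStar b R => (FreeStarAlg.lift f x : Q))
      fun x y => map_add (FreeStarAlg.lift f) x y) 1 fun x => ?_
  rw [one_mul]
  exact FreeStarAlg.norm_lift_le hf hb hR x

namespace UnivCStar

/-- The universal property of the universal C*-algebra of generators and relations. -/
noncomputable def lift (f : G → Q) (hf : ∀ g, f (star g) = star (f g))
    (hb : ∀ g, ‖f g‖ ≤ b g) (hR : ∀ r ∈ R, FreeStarAlg.lift f r = 0) : UnivCStar b R →⋆ₐ[ℂ] Q := by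
  let F : UnivCStar b R →+* Q := UniformSpace.Completion.extensionHom
    (show PreUnivCStar b R →+* Q from (FreeStarAlg.lift f).toRingHom)
    (PreUnivCStar.continuous_lift hf hb hR)
  have hF : Continuous F := UniformSpace.Completion.continuous_extension
  have hmk : ∀ x, F (mk x) = FreeStarAlg.lift f x := fun x =>
    UniformSpace.Completion.extensionHom_coe _ (PreUnivCStar.continuous_lift hf hb hR) x
  exact
    { F with
      commutes' := fun c => by
        change F _ = _
        rw [Algebra.algebraMap_eq_smul_one, ← mk_one, ← mk_smul, hmk, map_smul, map_one,
          Algebra.algebraMap_eq_smul_one]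
      map_star' := fun x => by
        change F (star x) = star (F x)
        induction x using mk_induction with
        | closed =>
          exact isClosed_eq (hF.comp continuous_star') (continuous_star.comp hF)
        | mk x => rw [star_mk, hmk, hmk, FreeStarAlg.lift_star hf] }

theorem lift_mk {f : G → Q} (hf : ∀ g, f (star g) = star (f g))
    (hb : ∀ g, ‖f g‖ ≤ b g) (hR : ∀ r ∈ R, FreeStarAlg.lift f r = 0) (x : FreeStarAlg G) :
    lift (R := R) f hf hb hR (mk x) = FreeStarAlg.lift f x :=
  UniformSpace.Completion.extensionHom_coe _ (PreUnivCStar.continuous_lift hf hb hR) x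

theorem lift_mk_gen {f : G → Q} (hf : ∀ g, f (star g) = star (f g))
    (hb : ∀ g, ‖f g‖ ≤ b g) (hR : ∀ r ∈ R, FreeStarAlg.lift f r = 0) (g : G) :
    lift (R := R) f hf hb hR (mk (.gen g)) = f g := by
  rw [lift_mk, FreeStarAlg.lift_gen]

/-- A subspace containing `1` and stable under left multiplication by the letters is dense. -/
theorem mem_topologicalClosure_of_gen_mul_mem (W : Submodule ℂ (UnivCStar b R)) (one : 1 ∈ W)
    (mul : ∀ g, ∀ x ∈ W, mk (.gen g) * x ∈ W) (x : UnivCStar b R) : x ∈ W.topologicalClosure := by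
  induction x using mk_induction with
  | closed => exact W.isClosed_topologicalClosure
  | mk x =>
    refine W.le_topologicalClosure ?_
    induction x using FreeStarAlg.induction_word with
    | zero =>
      have : (mk 0 : UnivCStar b R) = 0 := by simpa using mk_smul (b := b) (R := R) 0 0
      rw [this]
      exact W.zero_mem
    | add x y hx hy =>
      rw [mk_add]
      exact W.add_mem hx hy
    | single w c =>
      have : FreeStarAlg.word w c = c • FreeStarAlg.word w 1 := by simp [FreeStarAlg.smul_word]
      rw [this, mk_smul]
      refine W.smul_mem _ ?_
      clear this
      -- Letters are peeled off from the left, since only left multiplication by letters is known to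
      -- preserve `W`.
      induction w using FreeMonoid.recOn with
      | one => rwa [← FreeStarAlg.one_eq_word, mk_one]
      | of_mul g w ih =>
        have : FreeStarAlg.word (FreeMonoid.of g * w) 1
            = FreeStarAlg.gen g * FreeStarAlg.word w 1 := by
          simp [FreeStarAlg.gen, FreeStarAlg.word_mul_word]
        rw [this, mk_mul]
        exact mul g _ ih

/-- Continuous linear maps which agree on a subspace containing `1` and stable under left
multiplication by the letters are equal. -/
theorem eq_of_gen_mul_mem {V : Type*} [AddCommGroup V] [Module ℂ V] [TopologicalSpace V]
    [T2Space V] {F F' : UnivCStar b R →ₗ[ℂ] V} (hF : Continuous F) (hF' : Continuous F')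
    (W : Submodule ℂ (UnivCStar b R)) (one : 1 ∈ W)
    (mul : ∀ g, ∀ x ∈ W, mk (.gen g) * x ∈ W) (h : ∀ x ∈ W, F x = F' x) : F = F' := by
  ext x
  have hx := mem_topologicalClosure_of_gen_mul_mem W one mul x
  exact closure_minimal (t := {x | F x = F' x}) h (isClosed_eq hF hF') hx

/-- `*`-homomorphisms are contractive, hence continuous, and their equalizer contains `1` and is
stable under multiplication by the letters on which they agree. -/
theorem hom_ext {π π' : UnivCStar b R →⋆ₐ[ℂ] Q}
    (h : ∀ g, π (mk (.gen g)) = π' (mk (.gen g))) : π = π' := by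
  have hc : ∀ π : UnivCStar b R →⋆ₐ[ℂ] Q, Continuous π := fun π =>
    AddMonoidHomClass.continuous_of_bound π 1 fun x => by
      simpa using NonUnitalStarAlgHom.norm_apply_le π x
  have := eq_of_gen_mul_mem (F := π.toAlgHom.toLinearMap) (F' := π'.toAlgHom.toLinearMap)
    (hc π) (hc π') (LinearMap.eqLocus π.toAlgHom.toLinearMap π'.toAlgHom.toLinearMap)
    ((map_one π).trans (map_one π').symm) (fun g x hx => ?_) fun x hx => hx
  · ext x
    exact LinearMap.congr_fun this x
  · change π (_ * _) = π' (_ * _)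
    rw [map_mul, map_mul, h]
    congr 1

end UnivCStar

section Family

variable {ι : Type u} {C : ι → Type v} [∀ i, CStarAlgebra (C i)]

/-- The universal property of the free product of a family. -/
noncomputable def FreeProd.lift (π : ∀ i, C i →⋆ₐ[ℂ] Q) : FreeProd C →⋆ₐ[ℂ] Q :=
  UnivCStar.lift (fun g => match g with | .of i a => π i a)
    (by rintro ⟨i, a⟩; exact map_star (π i) a)
    (by rintro ⟨i, a⟩; exact NonUnitalStarAlgHom.norm_apply_le (π i) a)
    (by
      rintro r ⟨i, hr⟩
      exact FreeStarAlg.lift_isHomRelator (j := FamLetter.of i) (π i) (fun _ => rfl) hr)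

theorem FreeProd.lift_of (π : ∀ i, C i →⋆ₐ[ℂ] Q) (i : ι) (a : C i) :
    FreeProd.lift π (FreeProd.of C i a) = π i a :=
  UnivCStar.lift_mk_gen _ _ _ _

theorem FreeProd.hom_ext {π π' : FreeProd C →⋆ₐ[ℂ] Q}
    (h : ∀ i a, π (FreeProd.of C i a) = π' (FreeProd.of C i a)) : π = π' :=
  UnivCStar.hom_ext <| by rintro ⟨i, a⟩; exact h i a

end Family

section Pair

variable {A : Type u} {D : Type v} [CStarAlgebra A] [CStarAlgebra D]

/-- The universal property of the free product of two algebras. -/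
noncomputable def FreeProd₂.lift (π : A →⋆ₐ[ℂ] Q) (σ : D →⋆ₐ[ℂ] Q) : FreeProd₂ A D →⋆ₐ[ℂ] Q :=
  UnivCStar.lift (fun g => match g with | .inl a => π a | .inr d => σ d)
    (by rintro (a | a); exacts [map_star π a, map_star σ a])
    (by
      rintro (a | a)
      exacts [NonUnitalStarAlgHom.norm_apply_le π a, NonUnitalStarAlgHom.norm_apply_le σ a])
    (by
      rintro r (hr | hr)
      exacts [FreeStarAlg.lift_isHomRelator (j := PairLetter.inl) π (fun _ => rfl) hr,
        FreeStarAlg.lift_isHomRelator (j := PairLetter.inr) σ (fun _ => rfl) hr])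

theorem FreeProd₂.lift_inl (π : A →⋆ₐ[ℂ] Q) (σ : D →⋆ₐ[ℂ] Q) (a : A) :
    FreeProd₂.lift π σ (FreeProd₂.inl A D a) = π a :=
  UnivCStar.lift_mk_gen _ _ _ _

theorem FreeProd₂.lift_inr (π : A →⋆ₐ[ℂ] Q) (σ : D →⋆ₐ[ℂ] Q) (d : D) :
    FreeProd₂.lift π σ (FreeProd₂.inr A D d) = σ d :=
  UnivCStar.lift_mk_gen _ _ _ _

theorem FreeProd₂.hom_ext {π π' : FreeProd₂ A D →⋆ₐ[ℂ] Q}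
    (hl : ∀ a, π (FreeProd₂.inl A D a) = π' (FreeProd₂.inl A D a))
    (hr : ∀ d, π (FreeProd₂.inr A D d) = π' (FreeProd₂.inr A D d)) : π = π' :=
  UnivCStar.hom_ext <| by rintro (a | d); exacts [hl a, hr d]

end Pair

end Lift

/-! ### Free products of representations -/

section Amplification

variable (Y : Type*) (E : Type*) [NormedAddCommGroup E] [InnerProductSpace ℂ E] [CompleteSpace E]

open scoped InnerProductSpace

/-- The amplification `T ↦ T ⊗ 1` of bounded operators on `E` to `E ⊗ ℓ²(Y) = ⨁_Y E`. -/
noncomputable def amplify :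
    (E →L[ℂ] E) →⋆ₐ[ℂ] (lp (fun _ : Y => E) 2 →L[ℂ] lp (fun _ : Y => E) 2) where
  toFun T :=
    { toFun := fun f => ⟨fun y => T (f y),
        ((lp.memℓp f).norm.const_mul ‖T‖).mono fun y => T.le_opNorm (f y)⟩
      map_add' := fun f g => by ext y; exact map_add T (f y) (g y)
      map_smul' := fun c f => by ext y; exact map_smul T c (f y) : _ →ₗ[ℂ] _ }.mkContinuous ‖T‖
        fun f => by
          have : ‖T‖ * ‖f‖ = ‖(‖T‖ : ℂ) • f‖ := by rw [norm_smul]; simp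
          rw [this]
          refine lp.norm_mono (by simp) fun y => ?_
          change ‖T (f y)‖ ≤ ‖(‖T‖ : ℂ) • f y‖
          simpa [norm_smul] using T.le_opNorm (f y)
  map_one' := rfl
  map_mul' _ _ := rfl
  map_zero' := rfl
  map_add' _ _ := rfl
  commutes' _ := rfl
  map_star' T := by
    refine (ContinuousLinearMap.eq_adjoint_iff _ _).2 fun f g => ?_
    rw [lp.inner_eq_tsum, lp.inner_eq_tsum]
    exact tsum_congr fun y => ContinuousLinearMap.adjoint_inner_left T (g y) (f y)

variable {Y E}

theorem amplify_apply (T : E →L[ℂ] E) (f : lp (fun _ : Y => E) 2) (y : Y) :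
    amplify Y E T f y = T (f y) := rfl

end Amplification

/-- Conjugation of bounded operators by a unitary. -/
noncomputable def conjHom {H L : Type*} [NormedAddCommGroup H] [InnerProductSpace ℂ H]
    [CompleteSpace H] [NormedAddCommGroup L] [InnerProductSpace ℂ L] [CompleteSpace L]
    (e : H ≃ₗᵢ[ℂ] L) : (H →L[ℂ] H) →⋆ₐ[ℂ] (L →L[ℂ] L) where
  toFun := e.conjStarAlgEquiv
  map_one' := map_one _
  map_mul' := map_mul _
  map_zero' := map_zero _
  map_add' := map_add _
  commutes' c := by
    rw [Algebra.algebraMap_eq_smul_one, map_smul, map_one, Algebra.algebraMap_eq_smul_one]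
  map_star' := map_star _

/-- The Hilbert space `ℓ²(X, 𝕜)`. -/
abbrev SquareSummable (𝕜 : Type*) [RCLike 𝕜] (X : Type*) : Type _ := lp (fun _ : X => 𝕜) 2

/-- The complex Hilbert space `ℓ²(X)`. -/
abbrev EllTwo (X : Type*) : Type _ := SquareSummable ℂ X

/-- The basis vector `δ_x` of `ℓ²(X)`. -/
noncomputable def EllTwo.delta {X : Type*} (x : X) : EllTwo X := by
  classical exact lp.single 2 x 1

section EllTwo

open scoped InnerProductSpace

variable {X : Type*}

theorem EllTwo.delta_apply [DecidableEq X] (x y : X) :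
    EllTwo.delta x y = if y = x then 1 else 0 := by
  simp [EllTwo.delta, Pi.single_apply]

theorem EllTwo.inner_delta (x : X) (f : EllTwo X) : ⟪EllTwo.delta x, f⟫_ℂ = f x := by
  classical
  simp [EllTwo.delta, lp.inner_single_left]

end EllTwo

/-! ### The free product Hilbert space and its vacuum state. -/

namespace FreeHilbert

open Monoid.CoprodI EllTwo
open scoped InnerProductSpace

variable {ι : Type*} [DecidableEq ι] {M : ι → Type*} [∀ i, Monoid (M i)] [∀ i, DecidableEq (M i)]

/-- The reduced words which do not begin with a letter of index `i`. -/
abbrev WordsNotIn (M : ι → Type*) [∀ i, Monoid (M i)] (i : ι) : Type _ :=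
  {w : Word M // w.fstIdx ≠ some i}

/-- The tensor product of `ℓ²(M i)` with the span of the reduced words which do not begin with a
letter of index `i`. -/
abbrev Factored (M : ι → Type*) [∀ i, Monoid (M i)] (i : ι) : Type _ :=
  lp (fun _ : WordsNotIn M i => EllTwo (M i)) 2

/-- The basis vector of `Factored M i` corresponding to a reduced word. -/
noncomputable def factoredVec (i : ι) (w : Word M) : Factored M i := by
  classical
  exact lp.single 2 ⟨(Word.equivPair i w).tail, (Word.equivPair i w).fstIdx_ne⟩
    (delta (Word.equivPair i w).head)

theorem inner_factoredVec (i : ι) (w : Word M) (f : Factored M i) :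
    ⟪factoredVec i w, f⟫_ℂ =
      f ⟨(Word.equivPair i w).tail, (Word.equivPair i w).fstIdx_ne⟩ (Word.equivPair i w).head := by
  classical
  rw [factoredVec, lp.inner_single_left, inner_delta]

theorem inner_factoredVec_rcons (i : ι) (p : Word.Pair M i) (f : Factored M i) :
    ⟪factoredVec i (Word.rcons p), f⟫_ℂ = f ⟨p.tail, p.fstIdx_ne⟩ p.head := by
  have h : Word.equivPair i (Word.rcons p) = p := (Word.equivPair i).apply_symm_apply p
  rw [inner_factoredVec]
  rw [h]

/-- A reduced word is determined by its head in `M i` (possibly `1`) and its tail, so distinct words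
give distinct elementary basis vectors. -/
theorem orthonormal_factoredVec (i : ι) :
    Orthonormal ℂ (factoredVec i : Word M → Factored M i) := by
  classical
  rw [orthonormal_iff_ite]
  intro v w
  rw [inner_factoredVec]
  by_cases ht : (Word.equivPair i v).tail = (Word.equivPair i w).tail
  · by_cases hh : (Word.equivPair i v).head = (Word.equivPair i w).head
    · have hvw : v = w := (Word.equivPair i).injective (Word.Pair.ext hh ht)
      subst hvw
      simp [factoredVec, delta_apply]
    · have hvw : v ≠ w := fun h => hh (by rw [h])
      simp [factoredVec, ht, hvw, delta_apply, hh]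
  · have hvw : v ≠ w := fun h => ht (by rw [h])
    simp [factoredVec, hvw, ht]

/-- The orthonormal basis of `Factored M i` indexed by all reduced words. -/
noncomputable def factoredBasis (i : ι) : HilbertBasis (Word M) ℂ (Factored M i) :=
  HilbertBasis.mkOfOrthogonalEqBot (orthonormal_factoredVec i) <| by
    rw [Submodule.eq_bot_iff]
    intro f hf
    ext y s
    -- Every pair of a head `s` and a tail `y` comes from a word, so orthogonality to that word's
    -- vector kills the coordinate `f y s`.
    have h := (Submodule.mem_orthogonal _ _).1 hf (factoredVec i (Word.rcons ⟨s, y.1, y.2⟩))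
      (Submodule.subset_span ⟨_, rfl⟩)
    rwa [inner_factoredVec_rcons] at h

theorem repr_factoredBasis (i : ι) (f : Factored M i) (w : Word M) :
    (factoredBasis i).repr f w =
      f ⟨(Word.equivPair i w).tail, (Word.equivPair i w).fstIdx_ne⟩ (Word.equivPair i w).head := by
  rw [HilbertBasis.repr_apply_apply, factoredBasis, HilbertBasis.coe_mkOfOrthogonalEqBot,
    inner_factoredVec]

theorem repr_symm_factoredBasis (i : ι) (g : EllTwo (Word M)) (p : Word.Pair M i) :
    (factoredBasis i).repr.symm g ⟨p.tail, p.fstIdx_ne⟩ p.head = g (Word.rcons p) := by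
  rw [← inner_factoredVec_rcons]
  conv_rhs => rw [← (factoredBasis i).repr.apply_symm_apply g]
  rw [HilbertBasis.repr_apply_apply, factoredBasis, HilbertBasis.coe_mkOfOrthogonalEqBot]

/-- The left action of the operators on the `i`-th space on the free product Hilbert space. -/
noncomputable def leftAct (i : ι) :
    (EllTwo (M i) →L[ℂ] EllTwo (M i)) →⋆ₐ[ℂ] (EllTwo (Word M) →L[ℂ] EllTwo (Word M)) :=
  (conjHom (factoredBasis (M := M) i).repr).comp (amplify (WordsNotIn M i) (EllTwo (M i)))

/-- On vectors supported on words not beginning with a letter of index `i`, an operator on the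
`i`-th space acts by creation. -/
theorem leftAct_apply (i : ι) (T : EllTwo (M i) →L[ℂ] EllTwo (M i)) {g : EllTwo (Word M)}
    (hg : ∀ w, w.fstIdx = some i → g w = 0) (w : Word M) :
    leftAct i T g w =
      g (Word.equivPair i w).tail * T (delta 1) (Word.equivPair i w).head := by
  change (factoredBasis i).repr
    (amplify (WordsNotIn M i) (EllTwo (M i)) T ((factoredBasis i).repr.symm g)) w = _
  rw [repr_factoredBasis, amplify_apply]
  set p := Word.equivPair i w
  -- With the tail fixed, a head `s ≠ 1` gives a word beginning with index `i`, where `g` vanishes.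
  -- Only the coordinate at head `1` survives.
  have : (factoredBasis i).repr.symm g ⟨p.tail, p.fstIdx_ne⟩ = g p.tail • delta 1 := by
    ext s
    rw [repr_symm_factoredBasis i g ⟨s, p.tail, p.fstIdx_ne⟩]
    change _ = g p.tail * _
    rw [delta_apply]
    by_cases hs : s = 1
    · subst hs
      simp [Word.rcons]
    · rw [if_neg hs, mul_zero]
      apply hg
      rw [Word.rcons, dif_neg hs]
      exact Word.fstIdx_cons _ _ _ _
  rw [this, map_smul]
  rfl

/-- The vacuum vector. -/
noncomputable def vacuum (M : ι → Type*) [∀ i, Monoid (M i)] : EllTwo (Word M) := delta Word.empty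

theorem inner_vacuum_leftAct (i : ι) (T : EllTwo (M i) →L[ℂ] EllTwo (M i)) :
    ⟪vacuum M, leftAct i T (vacuum M)⟫_ℂ = ⟪delta 1, T (delta 1)⟫_ℂ := by
  have hf : (Word.empty : Word M).fstIdx ≠ some i := by simp [Word.fstIdx, Word.empty]
  have h : Word.equivPair i Word.empty = ⟨1, (Word.empty : Word M), hf⟩ :=
    Word.equivPair_eq_of_fstIdx_ne hf
  rw [inner_delta, vacuum, inner_delta, leftAct_apply]
  · rw [h]
    simp [delta_apply]
  · intro w hw
    rw [delta_apply, if_neg]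
    rintro rfl
    exact hf hw

/-- A word not beginning with index `i` has head `1`, so its coefficient carries the factor `⟪δ₁, T
δ₁⟫ = 0`. Thus a centred operator only creates words beginning with `i`. -/
theorem leftAct_centred {i : ι} {T : EllTwo (M i) →L[ℂ] EllTwo (M i)}
    (hT : ⟪delta 1, T (delta 1)⟫_ℂ = 0) {g : EllTwo (Word M)}
    (hg : ∀ w, w.fstIdx = some i → g w = 0) {w : Word M} (hw : w.fstIdx ≠ some i) :
    leftAct i T g w = 0 := by
  rw [inner_delta] at hT
  rw [leftAct_apply i T hg, Word.equivPair_eq_of_fstIdx_ne hw, hT, mul_zero]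

/-- The vacuum state is positive, and unital `*`-subalgebras acting through different left actions
are free with respect to it. -/
theorem areFree_vacuum {P : Type*} [CStarAlgebra P]
    (π : P →⋆ₐ[ℂ] (EllTwo (Word M) →L[ℂ] EllTwo (Word M))) (φ : P →ₗ[ℂ] ℂ)
    (hφ : ∀ x, φ x = ⟪vacuum M, π x (vacuum M)⟫_ℂ) (S : ι → StarSubalgebra ℂ P)
    (hS : ∀ i, ∀ x ∈ S i, ∃ T, π x = leftAct i T) : AreFree φ S := by
  intro n
  -- The induction needs a claim about the whole vector: `x₀ ⋯ xₙ Ω` is supported on words beginning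
  -- with the index of `x₀`. The empty word is not among these, so the vacuum expectation vanishes.
  suffices h : ∀ (i : Fin (n + 1) → ι) (x : Fin (n + 1) → P),
      (∀ k, x k ∈ S (i k)) → (∀ k, φ (x k) = 0) →
      (∀ k : Fin n, i k.castSucc ≠ i k.succ) →
      ∀ w : Word M, w.fstIdx ≠ some (i 0) → π (List.ofFn x).prod (vacuum M) w = 0 by
    intro i x hx hx0 hi
    rw [hφ, vacuum, inner_delta]
    exact h i x hx hx0 hi _ (by simp [Word.fstIdx, Word.empty])
  have act : ∀ (i : ι) (x : P), x ∈ S i → φ x = 0 → ∀ g : EllTwo (Word M),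
      (∀ w, w.fstIdx = some i → g w = 0) → ∀ w : Word M, w.fstIdx ≠ some i → π x g w = 0 := by
    intro i x hx hx0 g hg w hw
    obtain ⟨T, hT⟩ := hS i x hx
    rw [hφ, hT, inner_vacuum_leftAct] at hx0
    rw [hT]
    exact leftAct_centred hx0 hg hw
  induction n with
  | zero =>
    intro i x hx hx0 _ w hw
    have hp : (List.ofFn x).prod = x 0 := by simp
    rw [hp]
    refine act _ _ (hx 0) (hx0 0) _ (fun v hv => ?_) w hw
    rw [vacuum, delta_apply, if_neg]
    rintro rfl
    simp [Word.fstIdx, Word.empty] at hv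
  | succ n ih =>
    intro i x hx hx0 hi w hw
    rw [List.ofFn_succ, List.prod_cons, map_mul]
    refine act _ _ (hx 0) (hx0 0) _ (fun v hv => ?_) w hw
    -- The vector created by the remaining factors is supported on words beginning with `i 1`. As `i
    -- 1 ≠ i 0`, it vanishes on words beginning with `i 0`, as `act` requires.
    refine ih (fun k => i k.succ) (fun k => x k.succ) (fun k => hx _) (fun k => hx0 _)
      (fun k => by simpa using hi k.succ) v ?_
    rw [hv]
    simpa using hi 0

theorem isState_vacuum {P : Type*} [CStarAlgebra P]
    (π : P →⋆ₐ[ℂ] (EllTwo (Word M) →L[ℂ] EllTwo (Word M))) (φ : P →ₗ[ℂ] ℂ)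
    (hφ : ∀ x, φ x = ⟪vacuum M, π x (vacuum M)⟫_ℂ) : IsState φ := by
  constructor
  · rw [hφ, map_one]
    change ⟪vacuum M, vacuum M⟫_ℂ = 1
    rw [vacuum, inner_delta, delta_apply, if_pos rfl]
  · intro x
    rw [hφ, map_mul, map_star]
    change 0 ≤ ⟪vacuum M, ContinuousLinearMap.adjoint (π x) (π x (vacuum M))⟫_ℂ
    rw [ContinuousLinearMap.adjoint_inner_right, inner_self_eq_norm_sq_to_K]
    rw [← RCLike.ofReal_pow]
    exact RCLike.ofReal_nonneg.2 (sq_nonneg _)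

end FreeHilbert

/-! ### Existence of free product states -/

section GNS

universe w

open scoped InnerProductSpace

/-- The GNS representation of a state, in arbitrarily large universes. -/
theorem IsState.exists_gns {A : Type u} [CStarAlgebra A] {φ : A →ₗ[ℂ] ℂ} (hφ : IsState φ) :
    ∃ (H : Type u) (_ : NormedAddCommGroup H) (_ : InnerProductSpace ℂ H) (_ : CompleteSpace H)
      (π : A →⋆ₐ[ℂ] (H →L[ℂ] H)) (ξ : H), ‖ξ‖ = 1 ∧ ∀ a, φ a = ⟪ξ, π a ξ⟫_ℂ := by
  let _ : PartialOrder A := CStarAlgebra.spectralOrder A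
  have _ : StarOrderedRing A := CStarAlgebra.spectralOrderedRing A
  -- Non-negative elements are finite sums of elements `star y * y`, so the given positivity
  -- suffices.
  let f : A →ₚ[ℂ] ℂ := PositiveLinearMap.mk₀ φ fun x hx => by
    rw [StarOrderedRing.nonneg_iff] at hx
    induction hx using AddSubmonoid.closure_induction with
    | mem x hx =>
      obtain ⟨y, rfl⟩ := hx
      exact hφ.2 y
    | zero => simp
    | add x y _ _ hx hy =>
      rw [map_add]
      exact add_nonneg hx hy
  have hf : ∀ a, f a = φ a := fun _ => rfl
  let ξ : f.GNS := ((f.toPreGNS 1 : f.PreGNS) : f.GNS)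
  have key : ∀ a, φ a = ⟪ξ, f.gnsStarAlgHom a ξ⟫_ℂ := by
    intro a
    have : f.gnsStarAlgHom a ξ = ((f.leftMulMapPreGNS a (f.toPreGNS 1) : f.PreGNS) : f.GNS) :=
      f.gnsNonUnitalStarAlgHom_apply_coe
    rw [this, UniformSpace.Completion.inner_coe, f.preGNS_inner_def]
    simp [hf]
  refine ⟨f.GNS, inferInstance, inferInstance, inferInstance, f.gnsStarAlgHom, ξ, ?_, key⟩
  have h := key 1
  rw [hφ.1, map_one, one_apply_eq_self, inner_self_eq_norm_sq_to_K] at h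
  have h2 : ‖ξ‖ ^ 2 = 1 := by
    rw [← RCLike.ofReal_pow] at h
    exact RCLike.ofReal_injective (h.symm.trans RCLike.ofReal_one.symm)
  nlinarith [norm_nonneg ξ]

/-- In the GNS representation `φ` is a vector functional of a contractive homomorphism. Continuity
is what lets values on a dense span determine a state. -/
theorem IsState.continuous {A : Type u} [CStarAlgebra A] {φ : A →ₗ[ℂ] ℂ} (hφ : IsState φ) :
    Continuous φ := by
  obtain ⟨H, _, _, _, π, ξ, -, h⟩ := hφ.exists_gns
  have hπ : Continuous π := AddMonoidHomClass.continuous_of_bound π 1 fun x => by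
    simpa using NonUnitalStarAlgHom.norm_apply_le π x
  have : (φ : A → ℂ) = fun a => ⟪ξ, π a ξ⟫_ℂ := funext h
  rw [this]
  fun_prop

/-- The monoid with unit `e` in which all other elements are left zeros. -/
abbrev leftZeroMonoid {S : Type*} [DecidableEq S] (e : S) : Monoid S where
  one := e
  mul a b := if a = e then b else a
  one_mul a := if_pos rfl
  mul_one a := by
    change (if a = e then e else a) = a
    split_ifs with h
    exacts [h.symm, rfl]
  mul_assoc a b c := by
    change (if (if a = e then b else a) = e then c else (if a = e then b else a))
      = if a = e then (if b = e then c else b) else a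
    split_ifs <;> simp_all

/-- A state is a vector state at the unit basis vector of some `ℓ²(M)`. -/
theorem IsState.exists_rep_ellTwo {A : Type u} [CStarAlgebra A] {φ : A →ₗ[ℂ] ℂ} (hφ : IsState φ) :
    ∃ (M : Type (max u w)) (_ : Monoid M) (π : A →⋆ₐ[ℂ] (EllTwo M →L[ℂ] EllTwo M)),
      ∀ a, φ a = ⟪EllTwo.delta 1, π a (EllTwo.delta 1)⟫_ℂ := by
  classical
  obtain ⟨H, _, _, _, π, ξ, hξ, h⟩ := hφ.exists_gns
  have hs : Orthonormal ℂ ((↑) : ({ξ} : Set H) → H) := by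
    rw [orthonormal_subtype_iff_ite]
    rintro v rfl w rfl
    simp [inner_self_eq_norm_sq_to_K, hξ]
  obtain ⟨s, b, hsub, hb⟩ := hs.exists_hilbertBasis_extension
  let e : ULift.{max u w} s := ⟨⟨ξ, hsub rfl⟩⟩
  let b' : HilbertBasis (ULift.{max u w} s) ℂ H :=
    HilbertBasis.mk (v := fun i => b i.down) (b.orthonormal.comp _ ULift.down_injective) <| by
      have : Set.range (fun i : ULift.{max u w} s => b i.down) = Set.range b :=
        ULift.down_surjective.range_comp b
      rw [this, b.dense_span]
  have hb' : b' e = ξ := by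
    rw [HilbertBasis.coe_mk]
    change b (⟨ξ, hsub rfl⟩ : s) = ξ
    rw [hb]
  have hξe : b'.repr ξ = EllTwo.delta e := by
    rw [← hb', EllTwo.delta]
    convert b'.repr_self e
  -- Only the unit of the monoid matters: it marks the basis vector `ξ`, so that letters other than
  -- `1` index the orthogonal complement of `ξ` and `Monoid.CoprodI.Word` supplies the reduced
  -- words. The product itself is an arbitrary choice.
  refine ⟨ULift.{max u w} s, leftZeroMonoid e,
    (conjHom b'.repr).comp π, fun a => ?_⟩
  change φ a = ⟪EllTwo.delta e, b'.repr (π a (b'.repr.symm (EllTwo.delta e)))⟫_ℂ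
  rw [← hξe, LinearIsometryEquiv.symm_apply_apply, LinearIsometryEquiv.inner_map_map, h]

end GNS

section Existence

open FreeHilbert
open scoped InnerProductSpace

/-- The vector functional of a representation. -/
noncomputable def vectorFunctional {P H : Type*} [CStarAlgebra P] [NormedAddCommGroup H]
    [InnerProductSpace ℂ H] [CompleteSpace H] (π : P →⋆ₐ[ℂ] (H →L[ℂ] H)) (ξ : H) : P →ₗ[ℂ] ℂ where
  toFun x := ⟪ξ, π x ξ⟫_ℂ
  map_add' x y := by simp
  map_smul' c x := by simp

theorem exists_isFreeProductState {ι : Type*} {C : ι → Type v} [∀ i, CStarAlgebra (C i)]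
    {ω : ∀ i, C i →ₗ[ℂ] ℂ} (hω : ∀ i, IsState (ω i)) : ∃ φ, IsFreeProductState ω φ := by
  classical
  choose M _ π hπ using fun i => IsState.exists_rep_ellTwo.{v, v} (hω i)
  let Λ : FreeProd C →⋆ₐ[ℂ] _ := FreeProd.lift fun i => (leftAct (M := M) i).comp (π i)
  have hΛ : ∀ i a, Λ (FreeProd.of C i a) = leftAct i (π i a) := fun i a => FreeProd.lift_of _ i a
  refine ⟨vectorFunctional Λ (vacuum M), isState_vacuum Λ _ fun _ => rfl, fun i a => ?_,
    areFree_vacuum Λ _ (fun _ => rfl) _ ?_⟩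
  · change ⟪vacuum M, Λ _ (vacuum M)⟫_ℂ = _
    rw [hΛ, inner_vacuum_leftAct, hπ]
  · rintro i _ ⟨a, rfl⟩
    exact ⟨π i a, hΛ i a⟩

theorem exists_isFreeProductState₂ {A : Type u} {D : Type v} [CStarAlgebra A] [CStarAlgebra D]
    {ω : A →ₗ[ℂ] ℂ} {τ : D →ₗ[ℂ] ℂ} (hω : IsState ω) (hτ : IsState τ) :
    ∃ φ, IsFreeProductState₂ ω τ φ := by
  classical
  -- Both index sets are placed in the universe `max u v`, so that they form one family over `Bool`,
  -- with `true` for `A` as in `IsFreeProductState₂`.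
  obtain ⟨M₁, _, π, hπ⟩ := IsState.exists_rep_ellTwo.{u, v} hω
  obtain ⟨M₂, _, σ, hσ⟩ := IsState.exists_rep_ellTwo.{v, u} hτ
  let M : Bool → Type (max u v) := fun s => match s with
    | true => M₁
    | false => M₂
  let _ : ∀ s, Monoid (M s) := fun s => match s with
    | true => (inferInstance : Monoid M₁)
    | false => (inferInstance : Monoid M₂)
  let π' : A →⋆ₐ[ℂ] (EllTwo (M true) →L[ℂ] EllTwo (M true)) := π
  let σ' : D →⋆ₐ[ℂ] (EllTwo (M false) →L[ℂ] EllTwo (M false)) := σ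
  let Λ : FreeProd₂ A D →⋆ₐ[ℂ] _ :=
    FreeProd₂.lift ((leftAct (M := M) true).comp π') ((leftAct (M := M) false).comp σ')
  have hl : ∀ a, Λ (FreeProd₂.inl A D a) = leftAct true (π' a) := FreeProd₂.lift_inl _ _
  have hr : ∀ d, Λ (FreeProd₂.inr A D d) = leftAct false (σ' d) := FreeProd₂.lift_inr _ _
  refine ⟨vectorFunctional Λ (vacuum M), isState_vacuum Λ _ fun _ => rfl, fun a => ?_,
    fun d => ?_, areFree_vacuum Λ _ (fun _ => rfl) _ ?_⟩
  · change ⟪vacuum M, Λ _ (vacuum M)⟫_ℂ = _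
    rw [hl, inner_vacuum_leftAct, hπ]
  · change ⟪vacuum M, Λ _ (vacuum M)⟫_ℂ = _
    rw [hr, inner_vacuum_leftAct, hσ]
  · rintro (_ | _) x hx
    · obtain ⟨d, rfl⟩ : x ∈ (FreeProd₂.inr A D).range := by simpa using hx
      exact ⟨σ' d, hr d⟩
    · obtain ⟨a, rfl⟩ : x ∈ (FreeProd₂.inl A D).range := by simpa using hx
      exact ⟨π' a, hl a⟩

end Existence

/-! ### Reduced words in centred elements -/

section CentredWord

variable {ι P : Type*} [CStarAlgebra P]

/-- Products of `φ`-centred elements taken from subalgebras with consecutively different indices;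
the first argument records the index of the first factor. -/
inductive CentredWord (φ : P →ₗ[ℂ] ℂ) (S : ι → StarSubalgebra ℂ P) : Option ι → P → Prop
  | one : CentredWord φ S none 1
  | mul {i : ι} {a : P} {o : Option ι} {x : P} (ha : a ∈ S i) (h0 : φ a = 0) (ho : o ≠ some i)
      (hx : CentredWord φ S o x) : CentredWord φ S (some i) (a * x)

/-- The span of the reduced words in centred elements with first index in `O`. -/
noncomputable def centredSpan (φ : P →ₗ[ℂ] ℂ) (S : ι → StarSubalgebra ℂ P) (O : Set (Option ι)) :
    Submodule ℂ P :=
  Submodule.span ℂ {x | ∃ o ∈ O, CentredWord φ S o x}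

variable {φ φ' : P →ₗ[ℂ] ℂ} {S : ι → StarSubalgebra ℂ P}

theorem CentredWord.mem_span {o : Option ι} {x : P} (hx : CentredWord φ S o x)
    {O : Set (Option ι)} (ho : o ∈ O) : x ∈ centredSpan φ S O :=
  Submodule.subset_span ⟨o, ho, hx⟩

theorem centredSpan_mono {O O' : Set (Option ι)} (h : O ⊆ O') :
    centredSpan φ S O ≤ centredSpan φ S O' :=
  Submodule.span_mono fun _ ⟨o, ho, hx⟩ => ⟨o, h ho, hx⟩

theorem CentredWord.congr (h : ∀ i, ∀ a ∈ S i, φ a = φ' a) {o : Option ι} {x : P}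
    (hx : CentredWord φ S o x) : CentredWord φ' S o x := by
  induction hx with
  | one => exact .one
  | mul ha h0 ho _ ih => exact .mul ha (by rw [← h _ _ ha, h0]) ho ih

/-- Translates the inductive description, suited to induction on the first factor, into the tuples
quantified over in `AreFree`. -/
theorem CentredWord.exists_fin {o : Option ι} {x : P} (hx : CentredWord φ S o x) :
    ∀ i, o = some i → ∃ (n : ℕ) (f : Fin (n + 1) → ι) (y : Fin (n + 1) → P), f 0 = i ∧
      (∀ k, y k ∈ S (f k)) ∧ (∀ k, φ (y k) = 0) ∧ (∀ k : Fin n, f k.castSucc ≠ f k.succ) ∧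
      x = (List.ofFn y).prod := by
  induction hx with
  | one => simp
  | @mul i a o x ha h0 ho hx ih =>
    rintro _ ⟨rfl⟩
    cases o with
    | none =>
      cases hx
      exact ⟨0, fun _ => i, fun _ => a, rfl, fun _ => ha, fun _ => h0, fun k => k.elim0, by simp⟩
    | some j =>
      obtain ⟨n, f, y, hf, hy, hy0, hfs, rfl⟩ := ih j rfl
      refine ⟨n + 1, Fin.cons i f, Fin.cons a y, rfl, fun k => ?_, fun k => ?_, fun k => ?_, ?_⟩
      · cases k using Fin.cases with
        | zero => exact ha
        | succ k => exact hy k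
      · cases k using Fin.cases with
        | zero => exact h0
        | succ k => exact hy0 k
      · cases k using Fin.cases with
        | zero =>
          change i ≠ f 0
          rw [hf]
          rintro rfl
          exact ho rfl
        | succ k => exact hfs k
      · simp [List.ofFn_succ]

theorem AreFree.apply_centredWord (hφ : AreFree φ S) {i : ι} {x : P}
    (hx : CentredWord φ S (some i) x) : φ x = 0 := by
  obtain ⟨n, f, y, -, hy, hy0, hf, rfl⟩ := hx.exists_fin i rfl
  exact hφ n f y hy hy0 hf

theorem AreFree.apply_mem_span (hφ : AreFree φ S) {O : Set (Option ι)} (hO : none ∉ O) {x : P}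
    (hx : x ∈ centredSpan φ S O) : φ x = 0 := by
  induction hx using Submodule.span_induction with
  | mem x hx =>
    obtain ⟨_ | i, ho, hx⟩ := hx
    exacts [absurd ho hO, hφ.apply_centredWord hx]
  | zero => exact map_zero φ
  | add x y _ _ hx hy => rw [map_add, hx, hy, add_zero]
  | smul c x _ hx => rw [map_smul, hx, smul_zero]

theorem map_sub_smul_one (h1 : φ 1 = 1) (a : P) : φ (a - φ a • 1) = 0 := by
  simp [h1]

theorem StarSubalgebra.sub_smul_one_mem {T : StarSubalgebra ℂ P} {a : P} (ha : a ∈ T) (c : ℂ) :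
    a - c • 1 ∈ T :=
  sub_mem ha (T.smul_mem (one_mem T) c)

/-- An element of `S i` times a reduced word not beginning in `S i`. -/
theorem mul_centredWord_mem (h1 : φ 1 = 1) {i : ι} {a x : P} (ha : a ∈ S i) {o : Option ι}
    (ho : o ≠ some i) (hx : CentredWord φ S o x) : a * x ∈ centredSpan φ S {o, some i} := by
  -- Centring `a` splits the product into a longer reduced word and a multiple of `x`.
  have : a * x = (a - φ a • 1) * x + φ a • x := by simp [sub_mul]
  rw [this]
  refine Submodule.add_mem _ ?_ (Submodule.smul_mem _ _ (hx.mem_span (by simp)))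
  exact (CentredWord.mul (StarSubalgebra.sub_smul_one_mem ha _) (map_sub_smul_one h1 a) ho
    hx).mem_span (by simp)

/-- If the word already begins in `S i`, `a` is absorbed into its first factor; in either case the
new first factor is then centred. Together with `1` this makes the span dense. -/
theorem mul_mem_centredSpan (h1 : φ 1 = 1) {i : ι} {a x : P} (ha : a ∈ S i)
    (hx : x ∈ centredSpan φ S Set.univ) : a * x ∈ centredSpan φ S Set.univ := by
  induction hx using Submodule.span_induction with
  | mem x hx =>
    obtain ⟨o, -, hx⟩ := hx
    by_cases ho : o = some i
    · cases hx with
      | one => cases ho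
      | @mul j a' o' x' ha' h0 ho' hx' =>
        obtain rfl : j = i := Option.some_inj.1 ho
        rw [← mul_assoc]
        exact centredSpan_mono (Set.subset_univ _)
          (mul_centredWord_mem h1 (mul_mem ha ha') ho' hx')
    · exact centredSpan_mono (Set.subset_univ _) (mul_centredWord_mem h1 ha ho hx)
  | zero => rw [mul_zero]; exact Submodule.zero_mem _
  | add x y _ _ hx hy => rw [mul_add]; exact Submodule.add_mem _ hx hy
  | smul c x _ hx => rw [mul_smul_comm]; exact Submodule.smul_mem _ _ hx

theorem centred_mul_mem_span {i : ι} {a x : P} (ha : a ∈ S i) (h0 : φ a = 0)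
    {O : Set (Option ι)} (hO : some i ∉ O) (hx : x ∈ centredSpan φ S O) :
    a * x ∈ centredSpan φ S {some i} := by
  induction hx using Submodule.span_induction with
  | mem x hx =>
    obtain ⟨o, ho, hx⟩ := hx
    exact (CentredWord.mul ha h0 (fun h => hO (h ▸ ho)) hx).mem_span rfl
  | zero => rw [mul_zero]; exact Submodule.zero_mem _
  | add x y _ _ hx hy => rw [mul_add]; exact Submodule.add_mem _ hx hy
  | smul c x _ hx => rw [mul_smul_comm]; exact Submodule.smul_mem _ _ hx

/-- Right multiplication by an element of `S j` does not affect the beginning of a reduced word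
which starts elsewhere. -/
theorem CentredWord.mul_right_mem (h1 : φ 1 = 1) {j : ι} {d : P} (hd : d ∈ S j) {o : Option ι}
    {x : P} (hx : CentredWord φ S o x) :
    (∀ k, o = some k → k ≠ j → x * d ∈ centredSpan φ S {some k}) ∧
      (o = none ∨ o = some j → x * d ∈ centredSpan φ S {none, some j}) := by
  induction hx with
  | one =>
    refine ⟨by simp, fun _ => ?_⟩
    rw [one_mul, ← mul_one d]
    exact mul_centredWord_mem h1 hd (by simp) .one
  | @mul i a o x ha h0 ho hx ih =>
    -- If no word occurring in `x * d` begins in `S i`, `a` can be prefixed to all of them. The only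
    -- exception is `x = 1` with `i = j`, where `a` and `d` merge into a single element of `S j`.
    have main : a * x * d ∈ centredSpan φ S {some i} ∨ i = j ∧ o = none := by
      by_cases hoj : o = none ∨ o = some j
      · by_cases hij : i = j
        · refine .inr ⟨hij, hoj.resolve_right fun h => ho (by rw [h, hij])⟩
        · left
          rw [mul_assoc]
          exact centred_mul_mem_span ha h0 (by simpa using hij) (ih.2 hoj)
      · left
        obtain ⟨k, rfl⟩ := Option.ne_none_iff_exists'.1 fun h => hoj (.inl h)
        rw [mul_assoc]
        exact centred_mul_mem_span ha h0 (by simpa [eq_comm] using ho)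
          (ih.1 k rfl fun h => hoj (.inr (by rw [h])))
    refine ⟨fun k hk hkj => ?_, fun h => ?_⟩
    · obtain rfl : i = k := Option.some_inj.1 hk
      exact main.resolve_right fun h => hkj h.1
    · obtain rfl : i = j := by simpa using h
      rcases main with h | ⟨-, rfl⟩
      · exact centredSpan_mono (by simp) h
      · cases hx
        rw [mul_one]
        rw [← mul_one (a * d)]
        exact mul_centredWord_mem h1 (mul_mem ha hd) (by simp) .one

/-- Right multiplication by `d'` keeps the first index `k`, and left multiplication by `d` then
gives words beginning in `k` or `j`. No multiple of `1` appears, so `φ` vanishes. -/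
theorem AreFree.apply_mul_centredWord_mul (hφ : AreFree φ S) (h1 : φ 1 = 1) {j k : ι}
    (hkj : k ≠ j) {d d' x : P} (hd : d ∈ S j) (hd' : d' ∈ S j)
    (hx : CentredWord φ S (some k) x) : φ (d * x * d') = 0 := by
  have hxd := (hx.mul_right_mem h1 hd').1 k rfl hkj
  rw [mul_assoc]
  refine hφ.apply_mem_span (O := {some k, some j}) (by simp) ?_
  generalize x * d' = z at hxd
  induction hxd using Submodule.span_induction with
  | mem y hy =>
    obtain ⟨_, rfl, hy⟩ := hy
    exact mul_centredWord_mem h1 hd (by simpa using hkj) hy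
  | zero => rw [mul_zero]; exact Submodule.zero_mem _
  | add x y _ _ hx hy => rw [mul_add]; exact Submodule.add_mem _ hx hy
  | smul c x _ hx => rw [mul_smul_comm]; exact Submodule.smul_mem _ _ hx

/-- If `φ` is tracial on `S j`, then `S j` commutes with all reduced words under `φ`. -/
theorem AreFree.apply_mul_comm (hφ : AreFree φ S) (h1 : φ 1 = 1) {j : ι}
    (hj : ∀ a ∈ S j, ∀ d ∈ S j, φ (a * d) = φ (d * a)) {d x : P} (hd : d ∈ S j) {o : Option ι}
    (hx : CentredWord φ S o x) : φ (d * x) = φ (x * d) := by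
  cases hx with
  | one => simp
  | @mul i a o x ha h0 ho hx =>
    -- Traciality is needed only for a single letter of `S j`. For a longer word beginning in `S j`,
    -- `d` merges with the first letter on one side and stays at the end on the other, and both
    -- values vanish. For a word beginning elsewhere both values vanish directly.
    by_cases hij : i = j
    · subst hij
      cases o with
      | none =>
        cases hx
        simpa using hj d hd a ha
      | some k =>
        have hk : k ≠ i := by simpa using ho
        have hl := hφ.apply_mul_centredWord_mul h1 hk (mul_mem hd ha) (one_mem _) hx
        rw [mul_one, mul_assoc] at hl
        rw [hl, hφ.apply_mul_centredWord_mul h1 hk ha hd hx]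
    · have hx' := CentredWord.mul ha h0 ho hx
      have hl := hφ.apply_mul_centredWord_mul h1 hij hd (one_mem _) hx'
      have hr := hφ.apply_mul_centredWord_mul h1 hij (one_mem _) hd hx'
      rw [mul_one] at hl
      rw [one_mul] at hr
      rw [hl, hr]

end CentredWord

/-! ### Uniqueness of free product states, and their centralizers. -/

section Uniqueness

/-- Continuous functionals on a universal C*-algebra which agree on the reduced words in centred
elements are equal. -/
theorem UnivCStar.eq_of_centredWord {G ι : Type*} [InvolutiveStar G] {b : G → ℝ≥0}
    {R : Set (FreeStarAlg G)} {φ F F' : UnivCStar b R →ₗ[ℂ] ℂ}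
    {S : ι → StarSubalgebra ℂ (UnivCStar b R)} (h1 : φ 1 = 1)
    (hS : ∀ g, ∃ i, UnivCStar.mk (.gen g) ∈ S i) (hF : Continuous F) (hF' : Continuous F')
    (h : ∀ o x, CentredWord φ S o x → F x = F' x) : F = F' := by
  refine eq_of_gen_mul_mem hF hF' (centredSpan φ S Set.univ)
    (CentredWord.one.mem_span (Set.mem_univ _)) (fun g x hx => ?_) fun x hx => ?_
  · obtain ⟨i, hi⟩ := hS g
    exact mul_mem_centredSpan h1 hi hx
  · refine LinearMap.eqOn_span (f := F) (g := F') ?_ hx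
    rintro x ⟨o, -, hx⟩
    exact h o x hx

/-- Agreement on each `S i` makes centredness the same for both states. Both then vanish on all
nonempty reduced words and equal `1` at the empty one. -/
theorem UnivCStar.state_eq_of_areFree {G ι : Type*} [InvolutiveStar G] {b : G → ℝ≥0}
    {R : Set (FreeStarAlg G)} {φ φ' : UnivCStar b R →ₗ[ℂ] ℂ}
    {S : ι → StarSubalgebra ℂ (UnivCStar b R)} (hS : ∀ g, ∃ i, UnivCStar.mk (.gen g) ∈ S i)
    (hφ : IsState φ) (hφ' : IsState φ') (hf : AreFree φ S) (hf' : AreFree φ' S)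
    (h : ∀ i, ∀ a ∈ S i, φ a = φ' a) : φ = φ' := by
  refine eq_of_centredWord hφ.1 hS hφ.continuous hφ'.continuous fun o x hx => ?_
  cases o with
  | none =>
    cases hx
    rw [hφ.1, hφ'.1]
  | some i => rw [hf.apply_centredWord hx, hf'.apply_centredWord (hx.congr h)]

theorem IsFreeProductState.unique {ι : Type u} {C : ι → Type v} [∀ i, CStarAlgebra (C i)]
    {ω : ∀ i, C i →ₗ[ℂ] ℂ} {φ φ' : FreeProd C →ₗ[ℂ] ℂ} (hφ : IsFreeProductState ω φ)
    (hφ' : IsFreeProductState ω φ') : φ = φ' := by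
  refine UnivCStar.state_eq_of_areFree ?_ hφ.isState hφ'.isState hφ.free hφ'.free ?_
  · rintro ⟨i, a⟩
    exact ⟨i, a, rfl⟩
  · rintro i _ ⟨a, rfl⟩
    exact (hφ.of i a).trans (hφ'.of i a).symm

section Pair

variable {A : Type u} {D : Type v} [CStarAlgebra A] [CStarAlgebra D]
  {ω : A →ₗ[ℂ] ℂ} {τ : D →ₗ[ℂ] ℂ} {φ φ' : FreeProd₂ A D →ₗ[ℂ] ℂ}

theorem FreeProd₂.exists_gen_mem_range (g : PairLetter A D) :
    ∃ s : Bool, (UnivCStar.mk (.gen g) : FreeProd₂ A D) ∈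
      if s then (FreeProd₂.inl A D).range else (FreeProd₂.inr A D).range := by
  rcases g with a | d
  exacts [⟨true, a, rfl⟩, ⟨false, d, rfl⟩]

theorem IsFreeProductState₂.unique (hφ : IsFreeProductState₂ ω τ φ)
    (hφ' : IsFreeProductState₂ ω τ φ') : φ = φ' := by
  refine UnivCStar.state_eq_of_areFree FreeProd₂.exists_gen_mem_range hφ.isState hφ'.isState
    hφ.free hφ'.free ?_
  rintro (_ | _) x hx
  · obtain ⟨d, rfl⟩ : x ∈ (FreeProd₂.inr A D).range := by simpa using hx
    exact (hφ.inr d).trans (hφ'.inr d).symm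
  · obtain ⟨a, rfl⟩ : x ∈ (FreeProd₂.inl A D).range := by simpa using hx
    exact (hφ.inl a).trans (hφ'.inl a).symm

/-- If `τ` is a trace on `D`, then `D` lies in the centralizer of `ω * τ`. -/
theorem IsFreeProductState₂.apply_inr_mul (hφ : IsFreeProductState₂ ω τ φ)
    (hτ : ∀ c d, τ (c * d) = τ (d * c)) (d : D) (x : FreeProd₂ A D) :
    φ (FreeProd₂.inr A D d * x) = φ (x * FreeProd₂.inr A D d) := by
  have h1 := hφ.isState.1
  have hc := hφ.isState.continuous
  -- The functionals `φ (d ·)` and `φ (· d)` are continuous, so it is enough to compare them on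
  -- reduced words.
  refine LinearMap.congr_fun (UnivCStar.eq_of_centredWord (F := φ ∘ₗ LinearMap.mulLeft ℂ _)
    (F' := φ ∘ₗ LinearMap.mulRight ℂ _) h1 FreeProd₂.exists_gen_mem_range
    (hc.comp (continuous_const_mul _)) (hc.comp (continuous_mul_const _)) fun o x hx => ?_) x
  refine hφ.free.apply_mul_comm (j := false) h1 ?_ ⟨d, rfl⟩ hx
  rintro _ ⟨a, rfl⟩ _ ⟨d, rfl⟩
  change φ (FreeProd₂.inr A D a * FreeProd₂.inr A D d)
    = φ (FreeProd₂.inr A D d * FreeProd₂.inr A D a)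
  rw [← map_mul, ← map_mul, hφ.inr, hφ.inr, hτ]

end Pair

end Uniqueness

/-! ### Coefficients of elements of `B ⊗ U` -/

section Coefficients

variable {K : ℕ} {N : Fin K → ℕ} {U V : Type*} [CStarAlgebra U] [CStarAlgebra V]

namespace DirectSumMat

/-- The coefficient of `e^κ_{ij}` of an element of `B ⊗ U`. -/
noncomputable def coeff (κ : Fin K) (i j : Fin (N κ)) : DirectSumMat N ⊗[ℂ] U →ₗ[ℂ] U :=
  TensorProduct.lift <| LinearMap.mk₂ ℂ (fun (b : DirectSumMat N) u => b κ i j • u)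
    (fun b b' u => add_smul (b κ i j) (b' κ i j) u) (fun c b u => mul_smul c (b κ i j) u)
    (fun b u u' => smul_add (b κ i j) u u') (fun c b u => smul_comm (b κ i j) c u)

theorem coeff_tmul (κ : Fin K) (i j : Fin (N κ)) (b : DirectSumMat N) (u : U) :
    coeff κ i j (b ⊗ₜ[ℂ] u) = b κ i j • u := rfl

theorem eq_sum_e (b : DirectSumMat N) : b = ∑ κ, ∑ i, ∑ j, b κ i j • e N κ i j := by
  ext1 κ
  have h : ∀ κ' (i j : Fin (N κ')), (b κ' i j • e N κ' i j) κ =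
      if h : κ' = κ then b κ' i j • h ▸ Mat.e i j else 0 := by
    intro κ' i j
    split_ifs with h
    · subst h
      simp [e]
    · simp [e, Ne.symm h]
  simp only [Finset.sum_apply, h]
  rw [Finset.sum_eq_single κ]
  · simpa using Mat.eq_sum_e (b κ)
  · intro κ' _ h
    simp [h]
  · simp

theorem eq_sum_coeff (x : DirectSumMat N ⊗[ℂ] U) :
    x = ∑ κ, ∑ i, ∑ j, e N κ i j ⊗ₜ[ℂ] coeff κ i j x := by
  induction x using TensorProduct.induction_on with
  | zero => simp
  | tmul b u =>
    conv_lhs => rw [eq_sum_e b]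
    simp only [TensorProduct.sum_tmul, coeff_tmul, TensorProduct.smul_tmul]
  | add x y hx hy =>
    conv_lhs => rw [hx, hy]
    simp only [map_add, TensorProduct.tmul_add, Finset.sum_add_distrib]

/-- Reduces identities in `B ⊗ U` to identities between matrix entries in `U`. -/
theorem ext_coeff {x y : DirectSumMat N ⊗[ℂ] U} (h : ∀ κ i j, coeff κ i j x = coeff κ i j y) :
    x = y := by
  rw [eq_sum_coeff x, eq_sum_coeff y]
  simp only [h]

theorem coeff_sum (f : ∀ κ, Fin (N κ) → Fin (N κ) → U) (κ : Fin K) (i j : Fin (N κ)) :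
    coeff κ i j (∑ κ, ∑ i, ∑ j, e N κ i j ⊗ₜ[ℂ] f κ i j) = f κ i j := by
  simp only [map_sum, coeff_tmul]
  rw [Finset.sum_eq_single κ]
  · simp only [e, Pi.single_eq_same]
    simp [Mat.e, CStarMatrix.ofMatrix_apply, Matrix.single_apply, ite_and]
  · intro κ' _ h
    simp [e, Pi.single_eq_of_ne h.symm]
  · simp

theorem coeff_one (κ : Fin K) (i j : Fin (N κ)) :
    coeff κ i j (1 : DirectSumMat N ⊗[ℂ] U) = if i = j then 1 else 0 := by
  rw [Algebra.TensorProduct.one_def, coeff_tmul, Pi.one_apply, CStarMatrix.one_apply]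
  split_ifs <;> simp

theorem coeff_mul (κ : Fin K) (i j : Fin (N κ)) (x y : DirectSumMat N ⊗[ℂ] U) :
    coeff κ i j (x * y) = ∑ l, coeff κ i l x * coeff κ l j y := by
  induction x using TensorProduct.induction_on with
  | zero => simp
  | add x x' hx hx' => simp [add_mul, hx, hx', Finset.sum_add_distrib]
  | tmul b u =>
    induction y using TensorProduct.induction_on with
    | zero => simp
    | add y y' hy hy' => simp [mul_add, hy, hy', Finset.sum_add_distrib]
    | tmul b' u' =>
      simp only [Algebra.TensorProduct.tmul_mul_tmul, coeff_tmul, Pi.mul_apply,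
        CStarMatrix.mul_apply, Finset.sum_smul, smul_mul_smul_comm]

theorem coeff_star (κ : Fin K) (i j : Fin (N κ)) (x : DirectSumMat N ⊗[ℂ] U) :
    coeff κ i j (star x) = star (coeff κ j i x) := by
  induction x using TensorProduct.induction_on with
  | zero => simp
  | add x x' hx hx' => simp [hx, hx']
  | tmul b u =>
    rw [TensorProduct.star_tmul, coeff_tmul, coeff_tmul, star_smul, Pi.star_apply,
      CStarMatrix.star_apply]

theorem coeff_map (π : U →⋆ₐ[ℂ] V) (κ : Fin K) (i j : Fin (N κ)) (x : DirectSumMat N ⊗[ℂ] U) :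
    coeff κ i j (Algebra.TensorProduct.map (AlgHom.id ℂ (DirectSumMat N)) π.toAlgHom x)
      = π (coeff κ i j x) := by
  induction x using TensorProduct.induction_on with
  | zero => simp
  | add x x' hx hx' => simp [hx, hx']
  | tmul b u =>
    rw [Algebra.TensorProduct.map_tmul, coeff_tmul, coeff_tmul, map_smul]
    rfl

end DirectSumMat

end Coefficients

/-! ### Corners and matrices -/

namespace FreeMat

variable {A : Type*} [CStarAlgebra A] {n : ℕ} {Q : Type*} [CStarAlgebra Q]

/-- The homomorphism to a matrix algebra with prescribed matrix coefficients. -/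
noncomputable def matHom {P : Type*} [CStarAlgebra P] (f : Fin n → Fin n → P →ₗ[ℂ] Q)
    (one : ∀ i j, f i j 1 = if i = j then 1 else 0)
    (mul : ∀ i j x y, f i j (x * y) = ∑ l, f i l x * f l j y)
    (star : ∀ i j x, f i j (star x) = star (f j i x)) :
    P →⋆ₐ[ℂ] CStarMatrix (Fin n) (Fin n) Q where
  toFun x := CStarMatrix.ofMatrix (Matrix.of fun i j => f i j x)
  map_one' := CStarMatrix.ext fun i j => one i j
  map_mul' x y := CStarMatrix.ext fun i j => mul i j x y
  map_zero' := CStarMatrix.ext fun i j => map_zero (f i j)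
  map_add' x y := CStarMatrix.ext fun i j => map_add (f i j) x y
  commutes' c := CStarMatrix.ext fun i j => by
    change f i j (algebraMap ℂ P c) = _
    rw [Algebra.algebraMap_eq_smul_one, Algebra.algebraMap_eq_smul_one, map_smul,
      CStarMatrix.smul_apply, CStarMatrix.one_apply, one]
  map_star' x := CStarMatrix.ext fun i j => star i j x

/-- The homomorphism `M_n(ℂ) → M_n(Q)`. -/
noncomputable def scalarMat (n : ℕ) (Q : Type*) [CStarAlgebra Q] :
    Mat n →⋆ₐ[ℂ] CStarMatrix (Fin n) (Fin n) Q :=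
  matHom (P := Mat n) (fun i j =>
    { toFun := fun m => algebraMap ℂ Q (m i j)
      map_add' := fun x y => map_add (algebraMap ℂ Q) _ _
      map_smul' := fun c x => by
        rw [CStarMatrix.smul_apply, smul_eq_mul, map_mul, Algebra.smul_def, RingHom.id_apply] })
    (fun i j => by
      change algebraMap ℂ Q ((1 : Mat n) i j) = _
      rw [CStarMatrix.one_apply]
      split_ifs <;> simp)
    (fun i j x y => by
      change algebraMap ℂ Q ((x * y) i j) = ∑ l, algebraMap ℂ Q (x i l) * algebraMap ℂ Q (y l j)
      rw [CStarMatrix.mul_apply, map_sum]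
      simp only [map_mul])
    (fun i j x => by
      change algebraMap ℂ Q (star x i j) = star (algebraMap ℂ Q (x j i))
      rw [CStarMatrix.star_apply, algebraMap_star_comm])

theorem scalarMat_apply (m : Mat n) (i j : Fin n) :
    scalarMat n Q m i j = algebraMap ℂ Q (m i j) := rfl

theorem scalarMat_e (k l i j : Fin n) :
    scalarMat n Q (Mat.e k l) i j = if k = i ∧ l = j then 1 else 0 := by
  rw [scalarMat_apply, Mat.e, CStarMatrix.ofMatrix_apply, Matrix.single_apply]
  split_ifs <;> simp

theorem star_e (i j : Fin n) : star (e A i j) = e A j i := by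
  rw [e, ← map_star, Mat.star_e, e]

theorem sum_e (n : ℕ) : ∑ i, e A (i : Fin n) i = 1 := by
  simp only [e, ← map_sum]
  rw [← map_one (FreeProd₂.inr A (Mat n)), Mat.eq_sum_e 1]
  congr 1
  refine Finset.sum_congr rfl fun i _ => ?_
  rw [Finset.sum_eq_single i]
  · simp
  · intro j _ h
    simp [h.symm]
  · simp

variable [NeZero n]

/-- The element `e_{1i} x e_{j1}` of the corner `e₁₁ (A * M_n(ℂ)) e₁₁`. -/
noncomputable def block (i j : Fin n) (x : FreeMat A n) : Corner₁₁ A n :=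
  ⟨e A 0 i * x * e A j 0, by simp only [mul_assoc, e_mul_e_mul],
    by simp only [mul_assoc, e_mul_e]⟩

theorem corner_ext {x y : Corner₁₁ A n} (h : x.1 = y.1) : x = y := Subtype.ext h

theorem block_val (x : Corner₁₁ A n) : block 0 0 x.1 = x := by
  refine corner_ext ?_
  change e A 0 0 * x.1 * e A 0 0 = x.1
  rw [x.2.1, x.2.2]

theorem block_one (i j : Fin n) :
    (block i j 1 : Corner₁₁ A n) = if i = j then 1 else 0 := by
  refine corner_ext ?_
  change e A 0 i * 1 * e A j 0 = _
  rw [mul_one]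
  split_ifs with h
  · subst h
    exact e_mul_e A _ _ _
  · exact e_mul_e_of_ne A h

theorem block_add (i j : Fin n) (x y : FreeMat A n) :
    block i j (x + y) = block i j x + block i j y :=
  corner_ext <| by
    change e A 0 i * (x + y) * e A j 0 = e A 0 i * x * e A j 0 + e A 0 i * y * e A j 0
    rw [mul_add, add_mul]

theorem block_smul (i j : Fin n) (c : ℂ) (x : FreeMat A n) :
    block i j (c • x) = c • block i j x :=
  corner_ext <| by
    change e A 0 i * (c • x) * e A j 0 = c • (e A 0 i * x * e A j 0)
    rw [mul_smul_comm, smul_mul_assoc]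

/-- `block i j` as a linear map. -/
noncomputable def blockₗ (i j : Fin n) : FreeMat A n →ₗ[ℂ] Corner₁₁ A n where
  toFun := block i j
  map_add' := block_add i j
  map_smul' := block_smul i j

theorem val_sum {ι : Type*} (s : Finset ι) (f : ι → Corner₁₁ A n) :
    (∑ i ∈ s, f i).1 = ∑ i ∈ s, (f i).1 :=
  map_sum (Corner.incl (e A (0 : Fin n) 0) (isStarProjection_e A 0)) f s

/-- Insert `1 = ∑ e_{ll} = ∑ e_{l0} e_{0l}` between the factors. This makes the blocks behave as
entries of a matrix over the corner. -/
theorem block_mul (i j : Fin n) (x y : FreeMat A n) :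
    block i j (x * y) = ∑ l, block i l x * block l j y := by
  refine corner_ext ?_
  rw [val_sum]
  change e A 0 i * (x * y) * e A j 0 =
    ∑ l, (e A 0 i * x * e A l 0) * (e A 0 l * y * e A j 0)
  have : ∀ l, (e A 0 i * x * e A l 0) * (e A 0 l * y * e A j 0)
      = (e A 0 i * x) * (e A l l * (y * e A j 0)) := by
    intro l
    simp only [mul_assoc, e_mul_e_mul]
  simp only [this]
  rw [← Finset.mul_sum, ← Finset.sum_mul, sum_e, one_mul]
  simp only [mul_assoc]

theorem block_star (i j : Fin n) (x : FreeMat A n) : block i j (star x) = star (block j i x) := by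
  refine corner_ext ?_
  change e A 0 i * star x * e A j 0 = star (e A 0 j * x * e A i 0)
  rw [star_mul, star_mul, star_e, star_e, mul_assoc]

/-- By linearity this is a computation with matrix units. Its use is that a homomorphism on the
corner has no freedom on blocks of scalar matrices. -/
theorem block_inr (i j : Fin n) (m : Mat n) :
    (block i j (FreeProd₂.inr A (Mat n) m) : Corner₁₁ A n) = algebraMap ℂ _ (m i j) := by
  have h : ∀ k l, (block i j (FreeProd₂.inr A (Mat n) (Mat.e k l)) : Corner₁₁ A n) =
      if i = k ∧ l = j then 1 else 0 := by
    intro k l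
    refine corner_ext ?_
    change e A 0 i * e A k l * e A j 0 = _
    by_cases hk : i = k
    · subst hk
      rw [e_mul_e]
      by_cases hl : l = j
      · subst hl
        rw [e_mul_e, if_pos ⟨rfl, rfl⟩]
        rfl
      · rw [e_mul_e_of_ne A hl, if_neg fun h => hl h.2]
        rfl
    · rw [e_mul_e_of_ne A hk, zero_mul, if_neg fun h => hk h.1]
      rfl
  have h2 : blockₗ i j (FreeProd₂.inr A (Mat n) m) =
      ∑ k, ∑ l, m k l • (if i = k ∧ l = j then (1 : Corner₁₁ A n) else 0) := by
    conv_lhs => rw [Mat.eq_sum_e m]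
    simp only [map_sum, map_smul]
    simp only [← h]
    rfl
  refine h2.trans ?_
  rw [Finset.sum_eq_single i, Finset.sum_eq_single j]
  · rw [if_pos ⟨rfl, rfl⟩, Algebra.algebraMap_eq_smul_one]
  · intro l _ hl
    rw [if_neg fun h => hl h.2, smul_zero]
  · simp
  · intro k _ hk
    refine Finset.sum_eq_zero fun l _ => ?_
    rw [if_neg fun h => hk h.1.symm, smul_zero]
  · simp

/-- The homomorphism `A * M_n(ℂ) → M_n(Q)` induced by a homomorphism `e₁₁ (A * M_n(ℂ)) e₁₁ → Q`. -/
noncomputable def toMat (η : Corner₁₁ A n →⋆ₐ[ℂ] Q) :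
    FreeMat A n →⋆ₐ[ℂ] CStarMatrix (Fin n) (Fin n) Q :=
  matHom (fun i j => η.toAlgHom.toLinearMap ∘ₗ blockₗ i j)
    (fun i j => by
      change η (block i j 1) = _
      rw [block_one]
      split_ifs <;> simp)
    (fun i j x y => by
      change η (block i j (x * y)) = ∑ l, η (block i l x) * η (block l j y)
      simp only [block_mul, map_sum, map_mul])
    (fun i j x => by
      change η (block i j (star x)) = star (η (block j i x))
      rw [block_star, map_star])

theorem toMat_apply (η : Corner₁₁ A n →⋆ₐ[ℂ] Q) (x : FreeMat A n) (i j : Fin n) :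
    toMat η x i j = η (block i j x) := rfl

/-- The elements `e_{1i} a e_{j1}` generate the corner `e₁₁ (A * M_n(ℂ)) e₁₁`. -/
theorem corner_hom_ext {η η' : Corner₁₁ A n →⋆ₐ[ℂ] Q}
    (h : ∀ i j a, η (cornerCoeff i j a) = η' (cornerCoeff i j a)) : η = η' := by
  -- The C*-structure on matrices over `Q` is built from the order of `Q`.
  let _ : PartialOrder Q := CStarAlgebra.spectralOrder Q
  have _ : StarOrderedRing Q := CStarAlgebra.spectralOrderedRing Q
  -- On `A` the entries are the values `η (e_{0i} a e_{j0})`, equal by hypothesis; on `M_n(ℂ)` they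
  -- are scalars.
  have : toMat η = toMat η' := by
    refine FreeProd₂.hom_ext (Q := CStarMatrix (Fin n) (Fin n) Q) (fun a => ?_) fun d => ?_
    · ext i j
      exact h i j a
    · ext i j
      rw [toMat_apply, toMat_apply, block_inr, AlgHomClass.commutes, AlgHomClass.commutes]
  ext x
  rw [← block_val x, ← toMat_apply, this, toMat_apply]

/-- The homomorphism `e₁₁ (A * M_n(ℂ)) e₁₁ → Q` induced by a homomorphism `A * M_n(ℂ) → M_n(Q)`
which preserves the matrix units. -/
noncomputable def ofMat (F : FreeMat A n →⋆ₐ[ℂ] CStarMatrix (Fin n) (Fin n) Q)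
    (hF : ∀ i j, F (e A i j) = scalarMat n Q (Mat.e i j)) : Corner₁₁ A n →⋆ₐ[ℂ] Q where
  toFun x := F x.1 0 0
  map_one' := by
    change F (e A 0 0) 0 0 = 1
    rw [hF, scalarMat_e, if_pos ⟨rfl, rfl⟩]
  map_mul' x y := by
    change F (x.1 * y.1) 0 0 = _
    rw [map_mul, CStarMatrix.mul_apply, Finset.sum_eq_single 0]
    · intro l _ hl
      -- Since `y = e_{00} y`, all rows of `F y` except row `0` vanish, which makes the `(0, 0)`
      -- entry multiplicative on the corner.
      rw [← y.2.1, map_mul, CStarMatrix.mul_apply, hF, Finset.sum_eq_zero, mul_zero]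
      intro k _
      rw [scalarMat_e, if_neg fun h => hl h.1.symm, zero_mul]
    · simp
  map_zero' := by
    change F 0 0 0 = 0
    simp
  map_add' x y := by
    change F (x.1 + y.1) 0 0 = _
    simp
  commutes' c := by
    rw [Algebra.algebraMap_eq_smul_one]
    change F (c • e A 0 0) 0 0 = _
    rw [map_smul, CStarMatrix.smul_apply, hF, scalarMat_e, if_pos ⟨rfl, rfl⟩,
      Algebra.algebraMap_eq_smul_one]
  map_star' x := by
    change F (star x.1) 0 0 = _
    rw [map_star, CStarMatrix.star_apply]

/-- The outer factors become scalar matrix units, which move the entry `(i, j)` to position `(0,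
0)`. -/
theorem ofMat_cornerCoeff {F : FreeMat A n →⋆ₐ[ℂ] CStarMatrix (Fin n) (Fin n) Q}
    (hF : ∀ i j, F (e A i j) = scalarMat n Q (Mat.e i j)) (i j : Fin n) (a : A) :
    ofMat F hF (cornerCoeff i j a) = F (of n a) i j := by
  change F (e A 0 i * of n a * e A j 0) 0 0 = _
  rw [map_mul, map_mul, hF, hF, CStarMatrix.mul_apply, Finset.sum_eq_single j,
    CStarMatrix.mul_apply, Finset.sum_eq_single i]
  · simp [scalarMat_e]
  · intro k _ hk
    simp [scalarMat_e, hk.symm]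
  · simp
  · intro k _ hk
    simp [scalarMat_e, hk.symm]
  · simp

end FreeMat

/-! ### The universal quantum homomorphism -/

section Universality

variable {A : Type u} [CStarAlgebra A] {K : ℕ} (N : Fin K → ℕ) [∀ κ, NeZero (N κ)]

open DirectSumMat FreeMat

variable (A) in
/-- The homomorphism `a ↦ ∑_{κ,i,j} e^κ_{ij} ⊗ ν_κ(e^κ_{1i} a e^κ_{j1})`. -/
noncomputable def cornerCoaction : A →⋆ₐ[ℂ] DirectSumMat N ⊗[ℂ] CornerFreeProd A N := by
  let f : ∀ κ, Fin (N κ) → Fin (N κ) → A → CornerFreeProd A N := fun κ i j a =>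
    FreeProd.of (fun κ => Corner₁₁ A (N κ)) κ (block i j (of (N κ) a))
  refine
    { toFun := fun a => ∑ κ, ∑ i, ∑ j, e N κ i j ⊗ₜ[ℂ] f κ i j a
      map_one' := ext_coeff fun κ i j => ?_
      map_mul' := fun a b => ext_coeff fun κ i j => ?_
      map_zero' := ext_coeff fun κ i j => ?_
      map_add' := fun a b => ext_coeff fun κ i j => ?_
      commutes' := fun c => ext_coeff fun κ i j => ?_
      map_star' := fun a => ext_coeff fun κ i j => ?_ }
  · rw [coeff_sum, coeff_one]
    simp only [f, map_one, block_one]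
    split_ifs <;> simp
  · simp only [coeff_mul, coeff_sum]
    simp only [f, map_mul, block_mul, map_sum]
  · rw [coeff_sum, map_zero]
    simp only [f, map_zero]
    exact (congrArg _ (map_zero (blockₗ i j))).trans (map_zero _)
  · rw [map_add]
    simp only [coeff_sum]
    simp only [f, map_add, block_add]
  · rw [coeff_sum, Algebra.algebraMap_eq_smul_one, Algebra.algebraMap_eq_smul_one, map_smul,
      coeff_one]
    simp only [f, map_smul, map_one, block_smul, block_one]
    split_ifs <;> simp
  · rw [coeff_star, coeff_sum, coeff_sum]
    simp only [f, map_star, block_star]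

theorem cornerCoaction_apply (a : A) :
    cornerCoaction A N a = ∑ κ, ∑ i, ∑ j, e N κ i j ⊗ₜ[ℂ]
      FreeProd.of (fun κ => Corner₁₁ A (N κ)) κ (cornerCoeff i j a) := rfl

variable {N}

theorem coeff_cornerCoaction (a : A) (κ : Fin K) (i j : Fin (N κ)) :
    coeff κ i j (cornerCoaction A N a) =
      FreeProd.of (fun κ => Corner₁₁ A (N κ)) κ (cornerCoeff i j a) := by
  rw [cornerCoaction_apply, coeff_sum]

/-- The coefficients of the quantum homomorphism generate `*_κ e^κ₁₁ (A * M_{N κ}(ℂ)) e^κ₁₁`. -/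
theorem cornerFreeProd_hom_ext {Q : Type*} [CStarAlgebra Q] {π π' : CornerFreeProd A N →⋆ₐ[ℂ] Q}
    (h : ∀ κ i j a, π (FreeProd.of (fun κ => Corner₁₁ A (N κ)) κ (cornerCoeff i j a)) =
      π' (FreeProd.of (fun κ => Corner₁₁ A (N κ)) κ (cornerCoeff i j a))) : π = π' := by
  refine FreeProd.hom_ext fun κ x => ?_
  have : π.comp (FreeProd.of (fun κ => Corner₁₁ A (N κ)) κ) =
      π'.comp (FreeProd.of (fun κ => Corner₁₁ A (N κ)) κ) :=
    corner_hom_ext fun i j a => h κ i j a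
  exact DFunLike.congr_fun this x

/-- The matrix of coefficients of a quantum homomorphism. -/
noncomputable def coeffHom {U : Type*} [CStarAlgebra U] (ρ : A →⋆ₐ[ℂ] DirectSumMat N ⊗[ℂ] U)
    (κ : Fin K) : A →⋆ₐ[ℂ] CStarMatrix (Fin (N κ)) (Fin (N κ)) U :=
  matHom (fun i j => coeff κ i j ∘ₗ ρ.toAlgHom.toLinearMap)
    (fun i j => (congrArg _ (map_one ρ)).trans (coeff_one κ i j))
    (fun i j a b => (congrArg _ (map_mul ρ a b)).trans (coeff_mul κ i j _ _))
    (fun i j a => (congrArg _ (map_star ρ a)).trans (coeff_star κ i j _))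

theorem isUniversalQuantumHom_cornerCoaction :
    IsUniversalQuantumHom.{u, u, v} (cornerCoaction A N) := by
  intro U' _ ρ'
  let _ : PartialOrder U' := CStarAlgebra.spectralOrder U'
  have _ : StarOrderedRing U' := CStarAlgebra.spectralOrderedRing U'
  -- The `κ`-th coefficient matrix of `ρ'` supplies the map on `A`, and the scalar matrices supply
  -- the map on `M_{N κ}(ℂ)`.
  let F : ∀ κ, FreeMat A (N κ) →⋆ₐ[ℂ] CStarMatrix (Fin (N κ)) (Fin (N κ)) U' := fun κ =>
    FreeProd₂.lift (Q := CStarMatrix (Fin (N κ)) (Fin (N κ)) U') (coeffHom ρ' κ)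
      (scalarMat (N κ) U')
  have hF : ∀ κ i j, F κ (FreeMat.e A i j) = scalarMat (N κ) U' (Mat.e i j) := fun κ i j =>
    FreeProd₂.lift_inr _ _ _
  have hFA : ∀ κ i j a, F κ (of (N κ) a) i j = coeff κ i j (ρ' a) := fun κ i j a => by
    rw [of, FreeProd₂.lift_inl]
    rfl
  refine ⟨FreeProd.lift fun κ => ofMat (F κ) (hF κ), fun a => ext_coeff fun κ i j => ?_,
    fun π hπ => cornerFreeProd_hom_ext fun κ i j a => ?_⟩
  · rw [coeff_map, coeff_cornerCoaction, FreeProd.lift_of, ofMat_cornerCoeff, hFA]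
  · rw [FreeProd.lift_of, ofMat_cornerCoeff, hFA, ← hπ, coeff_map, coeff_cornerCoaction]

end Universality

/-! ### Functoriality of free products and free product states -/

section Congr

variable {ι : Type u} {C C' : ι → Type v} [∀ i, CStarAlgebra (C i)] [∀ i, CStarAlgebra (C' i)]

/-- Free products of isomorphic families are isomorphic. -/
noncomputable def FreeProd.congr (e : ∀ i, C i ≃⋆ₐ[ℂ] C' i) : FreeProd C ≃⋆ₐ[ℂ] FreeProd C' :=
  StarAlgEquiv.ofStarAlgHom
    (FreeProd.lift fun i => (FreeProd.of C' i).comp (e i : C i →⋆ₐ[ℂ] C' i))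
    (FreeProd.lift fun i => (FreeProd.of C i).comp ((e i).symm : C' i →⋆ₐ[ℂ] C i))
    (FreeProd.hom_ext fun i a => by simp [FreeProd.lift_of])
    (FreeProd.hom_ext fun i a => by simp [FreeProd.lift_of])

theorem FreeProd.congr_of (e : ∀ i, C i ≃⋆ₐ[ℂ] C' i) (i : ι) (a : C i) :
    FreeProd.congr e (FreeProd.of C i a) = FreeProd.of C' i (e i a) := by
  change FreeProd.lift (fun i => (FreeProd.of C' i).comp (e i : C i →⋆ₐ[ℂ] C' i)) _ = _
  rw [FreeProd.lift_of]
  rfl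

/-- `Θ` sends the `i`-th factor into the `i`-th factor, so alternating words in centred elements go
to words of the same kind and freeness pulls back. -/
theorem IsFreeProductState.comp {ω : ∀ i, C i →ₗ[ℂ] ℂ} {ω' : ∀ i, C' i →ₗ[ℂ] ℂ}
    {ψ : FreeProd C' →ₗ[ℂ] ℂ} (hψ : IsFreeProductState ω' ψ) (e : ∀ i, C i → C' i)
    (he : ∀ i a, ω' i (e i a) = ω i a) (Θ : FreeProd C →⋆ₐ[ℂ] FreeProd C')
    (hΘ : ∀ i a, Θ (FreeProd.of C i a) = FreeProd.of C' i (e i a)) :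
    IsFreeProductState ω (ψ ∘ₗ Θ.toAlgHom.toLinearMap) where
  isState := by
    refine ⟨?_, fun x => ?_⟩
    · change ψ (Θ 1) = 1
      rw [map_one, hψ.isState.1]
    · change 0 ≤ ψ (Θ (star x * x))
      rw [map_mul, map_star]
      exact hψ.isState.2 _
  of i a := by
    change ψ (Θ _) = _
    rw [hΘ, hψ.of, he]
  free n f x hx hx0 hf := by
    change ψ (Θ _) = 0
    rw [map_list_prod, List.map_ofFn]
    refine hψ.free n f (Θ ∘ x) (fun k => ?_) hx0 hf
    obtain ⟨a, ha⟩ := hx k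
    refine ⟨e _ a, ?_⟩
    rw [Function.comp_apply, ← ha]
    exact (hΘ _ a).symm

theorem isFreeProductState_comp_iff {ω : ∀ i, C i →ₗ[ℂ] ℂ} {ω' : ∀ i, C' i →ₗ[ℂ] ℂ}
    {ψ : FreeProd C' →ₗ[ℂ] ℂ} (e : ∀ i, C i ≃⋆ₐ[ℂ] C' i) (he : ∀ i a, ω' i (e i a) = ω i a) :
    IsFreeProductState ω (ψ ∘ₗ
      (FreeProd.congr e : FreeProd C →⋆ₐ[ℂ] FreeProd C').toAlgHom.toLinearMap) ↔
      IsFreeProductState ω' ψ := by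
  refine ⟨fun h => ?_, fun h => h.comp (fun i => e i) he _ (FreeProd.congr_of e)⟩
  -- The converse is the same transport along the inverse isomorphism; the two composites cancel.
  have h2 := h.comp (ω := ω') (fun i => (e i).symm) (fun i a => by rw [← he]; simp)
    ((FreeProd.congr e).symm : FreeProd C' →⋆ₐ[ℂ] FreeProd C) fun i a => by
      change (FreeProd.congr e).symm _ = _
      rw [StarAlgEquiv.symm_apply_eq, FreeProd.congr_of, StarAlgEquiv.apply_symm_apply]
  convert h2
  ext x
  change ψ x = ψ (FreeProd.congr e ((FreeProd.congr e).symm x))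
  rw [StarAlgEquiv.apply_symm_apply]

end Congr

/-! ### The relative commutant and the corner -/

namespace Mat

variable {n : ℕ}

theorem tr_mul_comm (x y : Mat n) : tr n (x * y) = tr n (y * x) := by
  change (n : ℂ)⁻¹ * ∑ i, (x * y) i i = (n : ℂ)⁻¹ * ∑ i, (y * x) i i
  simp only [CStarMatrix.mul_apply]
  rw [Finset.sum_comm]
  simp only [mul_comm]

theorem tr_e (i : Fin n) : tr n (e i i) = (n : ℂ)⁻¹ := by
  change (n : ℂ)⁻¹ * ∑ k, e i i k k = _
  simp [e, CStarMatrix.ofMatrix_apply, Matrix.single_apply]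

theorem isState_tr [NeZero n] : IsState (tr n) := by
  refine ⟨?_, fun x => ?_⟩
  · change (n : ℂ)⁻¹ * ∑ i, (1 : Mat n) i i = 1
    simp
  · change 0 ≤ (n : ℂ)⁻¹ * ∑ i, (star x * x) i i
    refine mul_nonneg (by simp) (Finset.sum_nonneg fun i _ => ?_)
    rw [CStarMatrix.mul_apply]
    refine Finset.sum_nonneg fun j _ => ?_
    rw [CStarMatrix.star_apply]
    exact star_mul_self_nonneg _

end Mat

namespace FreeMat

variable {A : Type*} [CStarAlgebra A] {n : ℕ}

variable {ω : A →ₗ[ℂ] ℂ} {φ : FreeMat A n →ₗ[ℂ] ℂ}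

theorem apply_e (hφ : IsFreeProductState₂ ω (Mat.tr n) φ) (i : Fin n) :
    φ (e A i i) = (n : ℂ)⁻¹ := by
  rw [e, hφ.inr, Mat.tr_e]

theorem e_mul_of_mem_relCommutant {y : FreeMat A n} (hy : y ∈ relCommutant A n) (i j : Fin n) :
    e A i j * y = y * e A i j := by
  rw [relCommutant, StarSubalgebra.mem_centralizer_iff] at hy
  exact (hy _ ⟨Mat.e i j, rfl⟩).1

/-- Multiplying by `e_{kl}` on either side leaves just the one term `e_{ki} z e_{jl}` of the sum.
For `i = j = 0` the sum inverts the compression to the corner. -/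
theorem sum_conj_mem_relCommutant (i j : Fin n) (z : FreeMat A n) :
    ∑ r, e A r i * z * e A j r ∈ relCommutant A n := by
  rw [relCommutant, StarSubalgebra.mem_centralizer_iff]
  have key : ∀ m : Mat n, Commute (FreeProd₂.inr A (Mat n) m) (∑ r, e A r i * z * e A j r) := by
    intro m
    rw [Mat.eq_sum_e m, map_sum]
    refine Commute.sum_left _ _ _ fun k _ => ?_
    rw [map_sum]
    refine Commute.sum_left _ _ _ fun l _ => ?_
    rw [map_smul]
    refine Commute.smul_left ?_ _
    change e A k l * _ = _ * e A k l
    rw [Finset.mul_sum, Finset.sum_mul, Finset.sum_eq_single l, Finset.sum_eq_single k]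
    · simp only [mul_assoc, e_mul_e, e_mul_e_mul]
    · intro r _ hr
      rw [mul_assoc, e_mul_e_of_ne A hr, mul_zero]
    · simp
    · intro r _ hr
      rw [← mul_assoc, ← mul_assoc, e_mul_e_of_ne A hr.symm, zero_mul, zero_mul]
    · simp
  rintro _ ⟨m, rfl⟩
  refine ⟨key m, ?_⟩
  rw [← map_star]
  exact key (star m)

variable [NeZero n]

theorem block_val_of_mem_relCommutant {y : FreeMat A n} (hy : y ∈ relCommutant A n)
    (i j : Fin n) : (block i j y).1 = if i = j then e A 0 0 * y else 0 := by
  change e A 0 i * y * e A j 0 = _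
  rw [mul_assoc, ← e_mul_of_mem_relCommutant hy, ← mul_assoc]
  split_ifs with h
  · rw [h, e_mul_e]
  · rw [e_mul_e_of_ne A h, zero_mul]

/-- The compression homomorphism from the relative commutant to the corner. -/
noncomputable def commutantToCorner (A : Type*) [CStarAlgebra A] (n : ℕ) [NeZero n] :
    relCommutant A n →⋆ₐ[ℂ] Corner₁₁ A n where
  toFun y := block 0 0 y.1
  map_one' := (block_one 0 0).trans (if_pos rfl)
  map_mul' x y := by
    -- Elements of the relative commutant have vanishing off-diagonal blocks, so only the term `l =
    -- 0` remains.
    refine (block_mul 0 0 x.1 y.1).trans (Finset.sum_eq_single 0 (fun l _ hl => ?_) (by simp))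
    have : block 0 l x.1 = 0 := corner_ext <| by
      rw [block_val_of_mem_relCommutant x.2, if_neg hl.symm]
      rfl
    rw [this, zero_mul]
  map_zero' := map_zero (blockₗ 0 0)
  map_add' x y := block_add 0 0 x.1 y.1
  commutes' c := by
    rw [Algebra.algebraMap_eq_smul_one, Algebra.algebraMap_eq_smul_one]
    refine (block_smul 0 0 c _).trans ?_
    congr 1
    exact (block_one 0 0).trans (if_pos rfl)
  map_star' x := block_star 0 0 x.1

theorem sum_conj_block {y : FreeMat A n} (hy : y ∈ relCommutant A n) :
    ∑ r, e A r 0 * (block 0 0 y).1 * e A 0 r = y := by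
  have : ∀ r : Fin n, e A r 0 * (block 0 0 y).1 * e A 0 r = e A r r * y := by
    intro r
    rw [block_val_of_mem_relCommutant hy, if_pos rfl, e_mul_e_mul, mul_assoc,
      ← e_mul_of_mem_relCommutant hy, e_mul_e_mul]
  simp only [this]
  rw [← Finset.sum_mul, sum_e, one_mul]

theorem block_sum_conj (x : Corner₁₁ A n) :
    block 0 0 (∑ r, e A r 0 * x.1 * e A 0 r) = x := by
  refine corner_ext ?_
  change e A 0 0 * (∑ r, e A r 0 * x.1 * e A 0 r) * e A 0 0 = x.1
  rw [Finset.mul_sum, Finset.sum_mul, Finset.sum_eq_single 0]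
  · rw [x.2.1, x.2.2, x.2.1]
    exact x.2.2
  · intro r _ hr
    rw [mul_assoc (e A r 0), ← mul_assoc (e A 0 0), e_mul_e_of_ne A hr.symm, zero_mul, zero_mul]
  · simp

theorem bijective_commutantToCorner : Function.Bijective (commutantToCorner A n) := by
  refine ⟨fun x y h => Subtype.ext ?_, fun x =>
    ⟨⟨_, sum_conj_mem_relCommutant 0 0 x.1⟩, block_sum_conj x⟩⟩
  rw [← sum_conj_block x.2, ← sum_conj_block y.2]
  have h2 : block 0 0 x.1 = block 0 0 y.1 := h
  rw [h2]

/-- The relative commutant of `M_n(ℂ)` in `A * M_n(ℂ)` is isomorphic to the corner. -/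
noncomputable def commutantEquivCorner (A : Type*) [CStarAlgebra A] (n : ℕ) [NeZero n] :
    relCommutant A n ≃⋆ₐ[ℂ] Corner₁₁ A n :=
  StarAlgEquiv.ofBijective (commutantToCorner A n) bijective_commutantToCorner

theorem commutantEquivCorner_commCoeff (i j : Fin n) (a : A) :
    commutantEquivCorner A n (commCoeff i j a) = cornerCoeff i j a := by
  refine corner_ext ?_
  change e A 0 0 * (∑ r, e A r i * of n a * e A j r) * e A 0 0 = e A 0 i * of n a * e A j 0
  rw [Finset.mul_sum, Finset.sum_mul, Finset.sum_eq_single 0]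
  · simp only [mul_assoc, e_mul_e_mul, e_mul_e]
  · intro r _ hr
    rw [mul_assoc (e A r i), ← mul_assoc (e A 0 0), e_mul_e_of_ne A hr.symm, zero_mul, zero_mul]
  · simp

theorem isState_compress (hφ : IsFreeProductState₂ ω (Mat.tr n) φ) :
    IsState (compress φ (e A 0 0) (isStarProjection_e A 0)) := by
  refine ⟨?_, fun x => ?_⟩
  · change (φ (e A 0 0))⁻¹ * φ (e A 0 0) = 1
    rw [apply_e hφ]
    simp
  · change 0 ≤ (φ (e A 0 0))⁻¹ * φ (star x.1 * x.1)
    rw [apply_e hφ]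
    exact mul_nonneg (by simp) (hφ.isState.2 _)

theorem compress_commutantEquivCorner (hφ : IsFreeProductState₂ ω (Mat.tr n) φ)
    (y : relCommutant A n) :
    compress φ (e A 0 0) (isStarProjection_e A 0) (commutantEquivCorner A n y) = φ y.1 := by
  change (φ (e A 0 0))⁻¹ * φ (block 0 0 y.1).1 = φ y.1
  -- Write `e_{rr} = e_{r0} e_{0r}`, move `e_{r0}` to the right end by the centralizer property,
  -- then commute it past `y`.
  have h : ∀ r : Fin n, φ (e A r r * y.1) = φ (e A 0 0 * y.1) := by
    intro r
    rw [← e_mul_e_mul A r 0 r, e, hφ.apply_inr_mul Mat.tr_mul_comm]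
    change φ (e A 0 r * y.1 * e A r 0) = _
    rw [mul_assoc, ← e_mul_of_mem_relCommutant y.2, e_mul_e_mul]
  have hy : φ y.1 = n * φ (e A 0 0 * y.1) := by
    conv_lhs => rw [← one_mul y.1, ← sum_e, Finset.sum_mul, map_sum]
    simp [h]
  rw [block_val_of_mem_relCommutant y.2, if_pos rfl, apply_e hφ, inv_inv, hy]

end FreeMat

/-! ### The canonical state -/

section Canonical

variable {A : Type u} [CStarAlgebra A] {K : ℕ} {N : Fin K → ℕ}

open DirectSumMat FreeMat

theorem coeff_map_commutantCoaction {U : Type*} [CStarAlgebra U]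
    (π : CommutantFreeProd A N →⋆ₐ[ℂ] U) (a : A) (κ : Fin K) (i j : Fin (N κ)) :
    coeff κ i j (Algebra.TensorProduct.map (AlgHom.id ℂ (DirectSumMat N)) π.toAlgHom
      (commutantCoaction N a)) =
        π (FreeProd.of (fun κ => relCommutant A (N κ)) κ (commCoeff i j a)) := by
  rw [coeff_map, commutantCoaction, coeff_sum]

variable [∀ κ, NeZero (N κ)]

variable (A N) in
/-- The isomorphism between the two models of the universal algebra. -/
noncomputable def commutantFreeProdEquiv : CommutantFreeProd A N ≃⋆ₐ[ℂ] CornerFreeProd A N :=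
  FreeProd.congr fun κ => commutantEquivCorner A (N κ)

theorem commutantFreeProdEquiv_of (κ : Fin K) (i j : Fin (N κ)) (a : A) :
    commutantFreeProdEquiv A N (FreeProd.of (fun κ => relCommutant A (N κ)) κ (commCoeff i j a))
      = FreeProd.of (fun κ => Corner₁₁ A (N κ)) κ (cornerCoeff i j a) := by
  rw [commutantFreeProdEquiv, FreeProd.congr_of, commutantEquivCorner_commCoeff]

/-- Comparing coefficients, the intertwining relation prescribes `Θ` on the elements corresponding
to the `cornerCoeff i j a`. Those generate the free product of the corners, so `Θ` has no freedom
left. -/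
theorem eq_commutantFreeProdEquiv {Θ : CommutantFreeProd A N ≃⋆ₐ[ℂ] CornerFreeProd A N}
    (hΘ : ∀ a, Algebra.TensorProduct.map (AlgHom.id ℂ (DirectSumMat N))
      (Θ : CommutantFreeProd A N →⋆ₐ[ℂ] CornerFreeProd A N).toAlgHom (commutantCoaction N a)
        = cornerCoaction A N a) : Θ = commutantFreeProdEquiv A N := by
  have h : (Θ : CommutantFreeProd A N →⋆ₐ[ℂ] CornerFreeProd A N).comp
      ((commutantFreeProdEquiv A N).symm : CornerFreeProd A N →⋆ₐ[ℂ] CommutantFreeProd A N)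
        = .id ℂ _ := by
    refine cornerFreeProd_hom_ext fun κ i j a => ?_
    change Θ ((commutantFreeProdEquiv A N).symm _) = _
    have h1 := coeff_map_commutantCoaction
      (Θ : CommutantFreeProd A N →⋆ₐ[ℂ] CornerFreeProd A N) a κ i j
    rw [hΘ, coeff_cornerCoaction] at h1
    rw [← commutantFreeProdEquiv_of, StarAlgEquiv.symm_apply_apply, commutantFreeProdEquiv_of]
    exact h1.symm
  ext x
  have := DFunLike.congr_fun h (commutantFreeProdEquiv A N x)
  change Θ ((commutantFreeProdEquiv A N).symm (commutantFreeProdEquiv A N x)) = _ at this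
  rwa [StarAlgEquiv.symm_apply_apply] at this

theorem isCanonicalState_cornerCoaction_iff {ω : A →ₗ[ℂ] ℂ} {φ : ∀ κ, FreeMat A (N κ) →ₗ[ℂ] ℂ}
    (hφ : ∀ κ, IsFreeProductState₂ ω (Mat.tr (N κ)) (φ κ)) (ψ : CornerFreeProd A N →ₗ[ℂ] ℂ) :
    IsCanonicalState ω (cornerCoaction A N) ψ ↔
      IsFreeProductState
        (fun κ => compress (φ κ) (FreeMat.e A 0 0) (isStarProjection_e A 0)) ψ := by
  rw [← isFreeProductState_comp_iff
    (ω := fun κ => φ κ ∘ₗ (relCommutant A (N κ)).subtype.toAlgHom.toLinearMap)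
    (fun κ => commutantEquivCorner A (N κ))
    fun κ y => compress_commutantEquivCorner (hφ κ) y]
  constructor
  · rintro ⟨Θ, φ', hΘ, hφ', hψ⟩
    -- The states and the isomorphism hidden in the existential are forced, so the canonical state
    -- depends on no choice.
    obtain rfl : φ' = φ := funext fun κ => (hφ' κ).unique (hφ κ)
    rwa [eq_commutantFreeProdEquiv hΘ] at hψ
  · intro hψ
    refine ⟨commutantFreeProdEquiv A N, φ, fun a => ext_coeff fun κ i j => ?_, hφ, hψ⟩
    rw [coeff_map_commutantCoaction, coeff_cornerCoaction]
    exact commutantFreeProdEquiv_of κ i j a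

end Canonical

theorem mainTheorem8 {A : Type u} [CStarAlgebra A] {K : ℕ} (N : Fin K → ℕ)
    [∀ κ, NeZero (N κ)] :
    ∃ ρ : A →⋆ₐ[ℂ] DirectSumMat N ⊗[ℂ] CornerFreeProd A N,
      (∀ a, ρ a = ∑ κ, ∑ i, ∑ j, DirectSumMat.e N κ i j ⊗ₜ[ℂ]
        FreeProd.of (fun κ => FreeMat.Corner₁₁ A (N κ)) κ (FreeMat.cornerCoeff i j a)) ∧
      IsUniversalQuantumHom.{u, u, v} ρ ∧
      ∀ ω : A →ₗ[ℂ] ℂ, IsState ω →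
        (∀ κ, ∃! φ : FreeMat A (N κ) →ₗ[ℂ] ℂ, IsFreeProductState₂ ω (Mat.tr (N κ)) φ) ∧
        (∃! ψ : CornerFreeProd A N →ₗ[ℂ] ℂ, IsCanonicalState ω ρ ψ) ∧
        ∀ φ : ∀ κ, FreeMat A (N κ) →ₗ[ℂ] ℂ,
          (∀ κ, IsFreeProductState₂ ω (Mat.tr (N κ)) (φ κ)) →
          ∀ ψ : CornerFreeProd A N →ₗ[ℂ] ℂ,
            IsCanonicalState ω ρ ψ ↔
              IsFreeProductState
                (fun κ => compress (φ κ) (FreeMat.e A 0 0) (FreeMat.isStarProjection_e A 0)) ψ := by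
  refine ⟨cornerCoaction A N, cornerCoaction_apply N, isUniversalQuantumHom_cornerCoaction,
    fun ω hω => ?_⟩
  have hex : ∀ κ, ∃ φ, IsFreeProductState₂ ω (Mat.tr (N κ)) φ := fun κ =>
    exists_isFreeProductState₂ hω Mat.isState_tr
  refine ⟨fun κ => ?_, ?_, fun φ hφ ψ => isCanonicalState_cornerCoaction_iff hφ ψ⟩
  · obtain ⟨φ, hφ⟩ := hex κ
    exact ⟨φ, hφ, fun φ' hφ' => hφ'.unique hφ⟩
  · choose φ hφ using hex
    obtain ⟨ψ, hψ⟩ := exists_isFreeProductState fun κ => FreeMat.isState_compress (hφ κ)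
    refine ⟨ψ, (isCanonicalState_cornerCoaction_iff hφ ψ).2 hψ, fun ψ' hψ' => ?_⟩
    exact ((isCanonicalState_cornerCoaction_iff hφ ψ').1 hψ').unique hψ
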